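/- **Theorem 4.3.** Let $p$ be an odd prime. Write $[a]$ for the integer part of $a$, let $P_n(x)=\frac1{2^n}\sum_{k=0}^{[n/2]}\binom nk(-1)^k\binom{2n-2k}n x^{n-2k}$ be the $n$-th Legendre polynomial, let $\left(\frac{\cdot}{p}\right)$ be the Legendre symbol (for a $p$-adic integer: that of its residue modulo $p$), and let $\mathbb Z_{(p)}$ be the ring of rational numbers whose denominators are coprime to $p$. 1. Suppose $p>3$, $p\equiv 1,3\pmod 8$ and $p=c^2+2d^2$ with integers $c,d$ and $c\equiv 1\pmod 4$. Then for each square root $\sqrt{-2}$ of $-2$ in the ring of $p$-adic integers, $$P_{[p/3]}\left(\frac5{\sqrt{-2}}\right)\equiv(-1)^{[p/8]}\left(\frac{-2-\sqrt{-2}}p\right)2c\pmod p,$$ as a congruence modulo $p$ in the ring of $p$-adic integers. 2. If $p\equiv5,7\pmod 8$, then for each complex square root $\sqrt{-2}$ of $-2$, $$P_{[p/3]}\left(\frac5{\sqrt{-2}}\right)\equiv0\pmod p,$$ as a congruence modulo $p$ in the ring $\mathbb Z_{(p)}[\sqrt{-2}]$. 3. If $p\equiv1,3\pmod 8$ and $p=c^2+2d^2$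 with integers $c,d$, then, in $\mathbb Z_{(p)}$, $$\sum_{k=0}^{p-1}\frac{\binom{2k}k^2\binom{3k}k}{8^k}\equiv4c^2\pmod p.$$ 4. If $p\equiv5,7\pmod 8$, then, in $\mathbb Z_{(p)}$, $$\sum_{k=0}^{p-1}\frac{\binom{2k}k^2\binom{3k}k}{8^k}\equiv0\pmod{p^2}.$$ -/

import Mathlib

open Finset Polynomial

/-- The `n`-th Legendre polynomial
`P_n(x) = 2^{-n} ∑_{k=0}^{⌊n/2⌋} C(n,k) (-1)^k C(2n-2k,n) x^{n-2k}`, with rational coefficients. -/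
noncomputable def legendrePoly (n : ℕ) : ℚ[X] :=
  C (1 / 2 ^ n : ℚ) *
    ∑ k ∈ range (n / 2 + 1),
      C ((n.choose k : ℚ) * (-1) ^ k * ((2 * n - 2 * k).choose n : ℚ)) * X ^ (n - 2 * k)

/-- Congruence modulo `m` with respect to a ring `A` of integral elements of the field `K`:
`x - y ∈ m A`. -/
def CongrMod {K : Type*} [Field K] (A : Set K) (m : ℕ) (x y : K) : Prop :=
  ∃ z ∈ A, x - y = (m : K) * z

/-- The rational numbers whose denominator is coprime to `p`. -/
def pIntegralRat (p : ℕ) : Set ℚ := {q | q.den.Coprime p}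

/-- For a complex number `s` with `s² ∈ ℤ`, the ring of all `a + b s` where `a, b` are rational
numbers whose denominators are coprime to `p`. -/
def pIntegralAdjoin (p : ℕ) (s : ℂ) : Set ℂ :=
  {z | ∃ a ∈ pIntegralRat p, ∃ b ∈ pIntegralRat p, z = (a : ℂ) + (b : ℂ) * s}

/-- The `p`-adic integers, as a subset of `ℚ_[p]`. -/
def padicIntegers (p : ℕ) [Fact p.Prime] : Set ℚ_[p] := {x | ‖x‖ ≤ 1}

/-- The Legendre symbol `(a/p)` of a `p`-adic integer `a`, i.e. that of its residue mod `p`. -/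
noncomputable def padicLegendreSym (p : ℕ) [Fact p.Prime] (a : ℤ_[p]) : ℤ :=
  quadraticChar (ZMod p) (PadicInt.toZMod a)

/-!
Write `B_k = C(2k,k) C(3k,k)`, `n = (p - 1) / 2`, and let `χ` be the quadratic character mod `p`.

**Reduction to a cubic character sum.** Modulo `p` the polynomial `P_{[p/3]}(t)` becomes the
truncated hypergeometric sum `∑_{k ≤ p/3} B_k u^k` with `u = (1 - t) / 54` (`choose_third_mul`,
from the shifted Legendre form of `P_n`), and this sum is the coefficient of `x^{p-1}` in
`(4x³ + (x + u)²)^n`, the Hasse invariant of `y² = 4x³ + (x + u)²` (`coeff_hasse`). For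
`t = 5 / √-2` that curve is a twist, over any ring of characteristic `p` containing `√-2`, of the
curve `y² = f(x) = (x + 1)(x² - 6x + 1)`, which has complex multiplication by `ℤ[√-2]`. The
coefficient of `x^{p-1}` is equivariant under linear changes of variable in characteristic `p`
(`coeff_comp_linear`), so everything reduces to `S = ∑ χ(f(x))`, an integer defined over the prime
field (`hasse_eq`). Working in `ℤ[√-2] / (p)` treats the inert primes without a field extension.

**Evaluation of `S`.** Over `F[i]`, which may be split, let
`T(a) = ∑_z χ(N z) χ(Re(a z⁴))`. Then `T(1) = 2 (p - 1) S`, and `T(a b⁴) = χ(N b) T(a)`. Taking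
`b = 1 + i`, so that `b⁴ = -4`, gives `S = 0` when `χ(-2) = -1`. When `χ(-2) = 1` the second moment
`∑_a T(a)²` can be computed because `χ` sums to zero over lines, while the transformation rules
leave only two values of `T(a)²` besides zero; the result is `T(1)² + 2 T(g)² = 16 p (p - 1)²`
(`octicSum_one_sq_add`), whence `S = 2x` with `p = x² + 2r²`, and `x = ±c` by uniqueness of the
representation. The sign comes from `S` modulo `8`: a dihedral group of order `8` of Möbius
transformations acts freely on the points where the summand is `-1` (`eight_dvd_card_filter`).

**The sums of `A_k = C(2k,k)² C(3k,k)`.** Clausen's formula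
`∑ A_k (x (1 - 27x))^k = (∑ B_k x^k)²` holds for formal power series, since both sides are
annihilated by the same third-order differential operator (`coeff_sum_clausenArg`). Truncating at
`k < p` costs only multiples of `p²` (`sq_dvd_coeff_sub`). At `x = (2 + 5√-2) / 108` one has
`x (1 - 27x) = 1/8`, so the sum over `A_k / 8^k` is, modulo `p²`, the square of the sum treated
above.
-/

/-! ### Recurrences for the binomial coefficients -/

theorem choose_mul_choose_mul_factorial_pow (k : ℕ) :
    (2 * k).choose k * (3 * k).choose k * k.factorial ^ 3 = (3 * k).factorial := by
  have h1 := Nat.choose_mul_factorial_mul_factorial (show k ≤ 3 * k by omega)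
  have h2 := Nat.choose_mul_factorial_mul_factorial (show k ≤ 2 * k by omega)
  rw [show 3 * k - k = 2 * k by omega] at h1
  rw [show 2 * k - k = k by omega] at h2
  rw [← h1, ← h2]; ring

theorem choose_mul_choose_succ (k : ℕ) :
    (2 * (k + 1)).choose (k + 1) * (3 * (k + 1)).choose (k + 1) * (k + 1) ^ 2 =
      (2 * k).choose k * (3 * k).choose k * (3 * (3 * k + 1) * (3 * k + 2)) := by
  have h1 := choose_mul_choose_mul_factorial_pow k
  have h2 := choose_mul_choose_mul_factorial_pow (k + 1)
  have h3 : (3 * (k + 1)).factorial =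
      (3 * k + 3) * ((3 * k + 2) * ((3 * k + 1) * (3 * k).factorial)) := by
    rw [show 3 * (k + 1) = 3 * k + 2 + 1 by ring]
    simp [Nat.factorial_succ]
  rw [h3, ← h1, Nat.factorial_succ] at h2
  have h4 : 0 < (k + 1) * k.factorial ^ 3 := by positivity
  refine Nat.eq_of_mul_eq_mul_right h4 ?_
  linear_combination h2

theorem choose_sq_mul_choose_succ (k : ℕ) :
    (2 * (k + 1)).choose (k + 1) ^ 2 * (3 * (k + 1)).choose (k + 1) * (k + 1) ^ 3 =
      (2 * k).choose k ^ 2 * (3 * k).choose k * (6 * (2 * k + 1) * (3 * k + 1) * (3 * k + 2)) := by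
  have h1 := choose_mul_choose_succ k
  have h2 := Nat.succ_mul_centralBinom_succ k
  rw [Nat.centralBinom, Nat.centralBinom] at h2
  calc _ = ((k + 1) * (2 * (k + 1)).choose (k + 1)) *
        ((2 * (k + 1)).choose (k + 1) * (3 * (k + 1)).choose (k + 1) * (k + 1) ^ 2) := by ring
    _ = _ := by rw [h1, h2]; ring

/-! ### Clausen's formula for formal power series -/

section Clausen

local notation "δ" => PowerSeries.derivative ℚ
local notation "𝕏" => (PowerSeries.X : PowerSeries ℚ)

/-- The power series `∑ C(2k,k) C(3k,k) x^k`. -/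
noncomputable def cubicSeries : PowerSeries ℚ :=
  PowerSeries.mk fun k => ((2 * k).choose k * (3 * k).choose k : ℕ)

/-- The argument `x (1 - 27x)` in Clausen's formula, as a power series in `x`. -/
noncomputable def clausenArg : PowerSeries ℚ := 𝕏 - 27 * 𝕏 ^ 2

theorem derivative_const_eq_zero : δ 6 = 0 ∧ δ 27 = 0 ∧ δ 54 = 0 :=
  ⟨mod_cast (PowerSeries.derivative ℚ).map_natCast 6,
    mod_cast (PowerSeries.derivative ℚ).map_natCast 27,
    mod_cast (PowerSeries.derivative ℚ).map_natCast 54⟩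

theorem derivative_clausenArg : δ clausenArg = 1 - 54 * 𝕏 := by
  simp only [clausenArg, map_sub, Derivation.leibniz, Derivation.leibniz_pow, smul_eq_mul,
    PowerSeries.derivative_X, derivative_const_eq_zero, nsmul_eq_mul]
  push_cast
  ring

theorem derivative_derivative_clausenArg : δ (1 - 54 * 𝕏) = -54 := by
  simp [Derivation.leibniz, derivative_const_eq_zero]

theorem sq_derivative_clausenArg : (1 - 54 * 𝕏) ^ 2 = 1 - 108 * clausenArg := by
  unfold clausenArg; ring

/-- The hypergeometric equation `(P F')' = 6F` with `P = x (1 - 27x)`. -/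
theorem cubicSeries_ode :
    clausenArg * δ (δ cubicSeries) + (1 - 54 * 𝕏) * δ cubicSeries = 6 * cubicSeries := by
  have key : 𝕏 * δ (δ cubicSeries) + δ cubicSeries =
      27 * (𝕏 * (𝕏 * δ (δ cubicSeries))) + 54 * (𝕏 * δ cubicSeries) + 6 * cubicSeries := by
    ext n
    have e27 : (27 : PowerSeries ℚ) = PowerSeries.C 27 := (map_ofNat PowerSeries.C 27).symm
    have e54 : (54 : PowerSeries ℚ) = PowerSeries.C 54 := (map_ofNat PowerSeries.C 54).symm
    have e6 : (6 : PowerSeries ℚ) = PowerSeries.C 6 := (map_ofNat PowerSeries.C 6).symm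
    have h : ∀ k : ℕ, PowerSeries.coeff (k + 1) cubicSeries * (k + 1) ^ 2 =
        PowerSeries.coeff k cubicSeries * (3 * (3 * k + 1) * (3 * k + 2)) := by
      intro k
      simp only [cubicSeries, PowerSeries.coeff_mk]
      exact_mod_cast choose_mul_choose_succ k
    have h1 := h n
    rw [e27, e54, e6]
    rcases n with _ | _ | n <;>
    simp only [map_add, PowerSeries.coeff_C_mul, PowerSeries.coeff_succ_X_mul,
      PowerSeries.coeff_zero_X_mul, PowerSeries.coeff_derivative, zero_add] at h1 ⊢ <;>
    push_cast at h1 ⊢ <;> linear_combination h1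
  unfold clausenArg
  linear_combination key

/-- The third-order operator `P² D³ + 3 P P' D² + (1 - 186 P) D - 12 P'` with `P = x (1 - 27x)`:
the symmetric square of the hypergeometric operator of `cubicSeries_ode`. -/
noncomputable def clausenOp (G : PowerSeries ℚ) : PowerSeries ℚ :=
  clausenArg ^ 2 * δ (δ (δ G)) + 3 * clausenArg * (1 - 54 * 𝕏) * δ (δ G) +
    (1 - 186 * clausenArg) * δ G - 12 * (1 - 54 * 𝕏) * G

theorem clausenOp_cubicSeries_sq : clausenOp (cubicSeries ^ 2) = 0 := by
  have h := cubicSeries_ode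
  have h' := congrArg (fun f => δ f) h
  have h2 := sq_derivative_clausenArg
  simp only [map_add, Derivation.leibniz, smul_eq_mul, derivative_clausenArg,
    derivative_derivative_clausenArg, derivative_const_eq_zero] at h'
  unfold clausenOp
  simp only [sq cubicSeries, map_add, Derivation.leibniz, smul_eq_mul]
  set F := cubicSeries
  set F1 := δ F
  set F2 := δ F1
  set F3 := δ F2
  generalize 1 - 54 * 𝕏 = Q at *
  -- With `G = F²` and `(P F')' = 6F`, the second and third derivatives of `G` are eliminated by
  -- `P G' = 2 F (P F')` and one differentiation of the second-order equation.
  linear_combination (2 * F * clausenArg) * h' +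
    (6 * clausenArg * F1 + 2 * F * Q) * h - 2 * F * F1 * h2

/-- The operator acts on powers of `P` like a hypergeometric operator in the variable `P`:
`L(P^k) = P' (k³ P^{k-1} - c_k P^k)` with `c_k = 6 (2k + 1) (3k + 1) (3k + 2)`. -/
theorem clausenOp_pow_succ (k : ℕ) :
    clausenOp (clausenArg ^ (k + 1)) = (1 - 54 * 𝕏) *
      (((k : PowerSeries ℚ) + 1) ^ 3 * clausenArg ^ k -
      6 * (2 * ((k : PowerSeries ℚ) + 1) + 1) * (3 * ((k : PowerSeries ℚ) + 1) + 1) *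
        (3 * ((k : PowerSeries ℚ) + 1) + 2) * clausenArg ^ (k + 1)) := by
  have h2 := sq_derivative_clausenArg
  rcases k with _ | _ | k
  all_goals
    unfold clausenOp
    simp only [map_add, Derivation.leibniz, Derivation.leibniz_pow, smul_eq_mul,
      derivative_clausenArg, derivative_derivative_clausenArg, derivative_const_eq_zero,
      nsmul_eq_mul, Nat.add_sub_cancel, Derivation.map_one_eq_zero, Derivation.map_natCast, map_neg, map_zero,
      pow_zero, zero_add, pow_one, Nat.cast_zero, Nat.cast_one, Nat.cast_add, Nat.reduceAdd,
      Nat.reduceSub]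
    generalize 1 - 54 * 𝕏 = Q at *
    push_cast
  · linear_combination 0 * h2
  · linear_combination (6 * clausenArg * Q) * h2
  · linear_combination ((k + 3) * (k + 2) * (k + 1) * clausenArg ^ (k + 2) * Q +
      3 * (k + 3) * (k + 2) * clausenArg ^ (k + 2) * Q) * h2

theorem clausenOp_sub (G H : PowerSeries ℚ) :
    clausenOp (G - H) = clausenOp G - clausenOp H := by
  simp only [clausenOp, map_sub]; ring

theorem clausenOp_add_C_mul (G H : PowerSeries ℚ) (a : ℚ) :
    clausenOp (G + PowerSeries.C a * H) = clausenOp G + PowerSeries.C a * clausenOp H := by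
  have hd : ∀ F : PowerSeries ℚ, δ (PowerSeries.C a * F) = PowerSeries.C a * δ F := fun F => by
    rw [← PowerSeries.smul_eq_C_mul, ← PowerSeries.smul_eq_C_mul, Derivation.map_smul]
  simp only [clausenOp, map_add, hd]
  ring

theorem clausenOp_eq (G : PowerSeries ℚ) : clausenOp G =
    𝕏 * (𝕏 * δ (δ (δ G))) - PowerSeries.C 54 * (𝕏 * (𝕏 * (𝕏 * δ (δ (δ G)))))
      + PowerSeries.C 729 * (𝕏 * (𝕏 * (𝕏 * (𝕏 * δ (δ (δ G)))))) + PowerSeries.C 3 * (𝕏 * δ (δ G))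
      - PowerSeries.C 243 * (𝕏 * (𝕏 * δ (δ G))) + PowerSeries.C 4374 * (𝕏 * (𝕏 * (𝕏 * δ (δ G))))
      + δ G - PowerSeries.C 186 * (𝕏 * δ G) + PowerSeries.C 5022 * (𝕏 * (𝕏 * δ G))
      - PowerSeries.C 12 * G + PowerSeries.C 648 * (𝕏 * G) := by
  simp only [map_ofNat, clausenOp, clausenArg]
  ring

theorem coeff_clausenOp_zero (G : PowerSeries ℚ) :
    PowerSeries.coeff 0 (clausenOp G) = PowerSeries.coeff 1 G - 12 * PowerSeries.coeff 0 G := by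
  rw [clausenOp_eq]
  simp only [map_add, map_sub, PowerSeries.coeff_C_mul, PowerSeries.coeff_zero_X_mul,
    PowerSeries.coeff_derivative]
  push_cast
  ring_nf

/-- The operator gives a three-term recurrence whose leading coefficient never vanishes. -/
theorem coeff_clausenOp_succ (G : PowerSeries ℚ) (n : ℕ) :
    PowerSeries.coeff (n + 1) (clausenOp G) =
      ((n : ℚ) + 2) ^ 3 * PowerSeries.coeff (n + 2) G -
      (54 * ((n : ℚ) + 1) * n * (n - 1) + 243 * (n + 1) * n + 186 * (n + 1) + 12) *
        PowerSeries.coeff (n + 1) G +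
      (729 * (n : ℚ) * (n - 1) * (n - 2) + 4374 * n * (n - 1) + 5022 * n + 648) *
        PowerSeries.coeff n G := by
  rw [clausenOp_eq]
  rcases n with _ | _ | _ | n <;>
    simp only [map_add, map_sub, PowerSeries.coeff_C_mul, PowerSeries.coeff_succ_X_mul,
      PowerSeries.coeff_zero_X_mul, PowerSeries.coeff_derivative, zero_add] <;>
    push_cast <;> ring

theorem coeff_eq_zero_of_clausenOp {G : PowerSeries ℚ} {K : ℕ} (h0 : PowerSeries.coeff 0 G = 0)
    (h : ∀ n < K, PowerSeries.coeff n (clausenOp G) = 0) :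
    ∀ m ≤ K, PowerSeries.coeff m G = 0 := by
  intro m
  induction m using Nat.strong_induction_on with
  | _ m ih =>
    intro hm
    rcases m with _ | _ | m
    · exact h0
    · have := h 0 (by omega)
      rw [coeff_clausenOp_zero, h0] at this
      simpa using this
    · have := h (m + 1) (by omega)
      rw [coeff_clausenOp_succ, ih m (by omega) (by omega),
        ih (m + 1) (by omega) (by omega)] at this
      have h2 : ((m : ℚ) + 2) ^ 3 ≠ 0 := by positivity
      simpa [h2] using this

theorem coeff_clausenArg_pow_mul_of_lt {n k : ℕ} (h : n < k) (G : PowerSeries ℚ) :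
    PowerSeries.coeff n (clausenArg ^ k * G) = 0 := by
  have : clausenArg ^ k * G = 𝕏 ^ k * ((1 - 27 * 𝕏) ^ k * G) := by
    rw [← mul_assoc, ← mul_pow]; congr 2; unfold clausenArg; ring
  rw [this, PowerSeries.coeff_X_pow_mul', if_neg (by omega)]

/-- By the recurrence `choose_sq_mul_choose_succ` the sum telescopes, leaving a multiple of
`P ^ K`. -/
theorem clausenOp_sum (K : ℕ) :
    clausenOp (∑ k ∈ range (K + 1),
      PowerSeries.C (((2 * k).choose k ^ 2 * (3 * k).choose k : ℕ) : ℚ) * clausenArg ^ k) =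
      -PowerSeries.C ((K + 1 : ℚ) ^ 3 * ((2 * (K + 1)).choose (K + 1) ^ 2 *
        (3 * (K + 1)).choose (K + 1) : ℕ)) * ((1 - 54 * 𝕏) * clausenArg ^ K) := by
  induction K with
  | zero =>
    simp [clausenOp]
    left
    rw [map_ofNat]
  | succ K ih =>
    rw [sum_range_succ, clausenOp_add_C_mul, ih, clausenOp_pow_succ]
    have h := choose_sq_mul_choose_succ (K + 1)
    have h' : PowerSeries.C (((K + 1 : ℕ) + 1 : ℚ) ^ 3 * ((2 * (K + 1 + 1)).choose (K + 1 + 1) ^ 2 *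
        (3 * (K + 1 + 1)).choose (K + 1 + 1) : ℕ)) =
        (PowerSeries.C (((2 * (K + 1)).choose (K + 1) ^ 2 *
        (3 * (K + 1)).choose (K + 1) : ℕ) : ℚ)) * (6 * (2 * ((K : PowerSeries ℚ) + 1) + 1) *
        (3 * ((K : PowerSeries ℚ) + 1) + 1) * (3 * ((K : PowerSeries ℚ) + 1) + 2)) := by
      have := congrArg (Nat.cast : ℕ → PowerSeries ℚ) h
      push_cast at this
      simp only [map_mul, map_pow, map_add, map_natCast, map_one]
      push_cast
      linear_combination this
    rw [h', map_mul]
    simp only [map_pow, map_add, map_natCast, map_one]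
    push_cast
    ring

/-- Clausen's formula `∑ C(2k,k)² C(3k,k) (x (1 - 27x))^k = (∑ C(2k,k) C(3k,k) x^k)²`: the two sides
agree up to the degree where the left-hand side is truncated. -/
theorem coeff_sum_clausenArg (K m : ℕ) (hm : m ≤ K) :
    PowerSeries.coeff m (∑ k ∈ range (K + 1),
      PowerSeries.C (((2 * k).choose k ^ 2 * (3 * k).choose k : ℕ) : ℚ) * clausenArg ^ k) =
    PowerSeries.coeff m (cubicSeries ^ 2) := by
  rw [← sub_eq_zero, ← map_sub]
  refine coeff_eq_zero_of_clausenOp ?_ ?_ m hm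
  · rw [map_sub, sum_range_succ', map_add, map_sum, sum_eq_zero]
    · simp [cubicSeries]
    · intro k _
      rw [mul_comm, coeff_clausenArg_pow_mul_of_lt (by omega)]
  · intro n hn
    rw [clausenOp_sub, clausenOp_cubicSeries_sq, clausenOp_sum, sub_zero, neg_mul, map_neg,
      PowerSeries.coeff_C_mul, mul_comm (1 - 54 * 𝕏), coeff_clausenArg_pow_mul_of_lt hn,
      mul_zero, neg_zero]
end Clausen

/-! ### Clausen's formula modulo `p²` -/

theorem dvd_choose_mul_choose {p k : ℕ} (hp : p.Prime) (h1 : p ≤ 3 * k) (h2 : k < p) :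
    p ∣ (2 * k).choose k * (3 * k).choose k := by
  have h := choose_mul_choose_mul_factorial_pow k
  have h3 : p ∣ (3 * k).factorial := hp.dvd_factorial.2 h1
  rw [← h] at h3
  refine (hp.dvd_mul.1 h3).resolve_right fun h4 => ?_
  exact absurd (hp.dvd_factorial.1 (hp.dvd_of_dvd_pow h4)) (by omega)

theorem sq_dvd_choose_mul_choose {p k : ℕ} (hp : p.Prime) (h1 : 2 * p ≤ 3 * k) (h2 : k < p) :
    p ^ 2 ∣ (2 * k).choose k * (3 * k).choose k := by
  have h := choose_mul_choose_mul_factorial_pow k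
  have h3 : p ^ 2 ∣ (3 * k).factorial := by
    refine dvd_trans ?_ (Nat.factorial_dvd_factorial h1)
    refine dvd_trans ?_ (Nat.factorial_mul_factorial_dvd_factorial (show p ≤ 2 * p by omega))
    rw [sq, show 2 * p - p = p by omega]
    exact mul_dvd_mul (Nat.dvd_factorial hp.pos le_rfl) (Nat.dvd_factorial hp.pos le_rfl)
  rw [← h] at h3
  refine Nat.Coprime.dvd_of_dvd_mul_right ?_ h3
  refine Nat.Coprime.pow _ _ ((Nat.Prime.coprime_iff_not_dvd hp).2 fun h4 => ?_)
  exact absurd (hp.dvd_factorial.1 h4) (by omega)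

theorem sq_dvd_choose_sq_mul_choose {p k : ℕ} (hp : p.Prime) (h1 : p ≤ 2 * k) (h2 : k < p) :
    p ^ 2 ∣ (2 * k).choose k ^ 2 * (3 * k).choose k := by
  rw [sq, sq, mul_assoc]
  refine mul_dvd_mul ?_ (dvd_choose_mul_choose hp (by omega) h2)
  exact hp.dvd_choose h2 (by omega) h1

/-- The truncations at `k < p` of the two sides of Clausen's formula agree modulo `p²`. In degree
`m ≥ p` every contributing term is divisible by `p²`: on the left `2k ≥ p`, and on the right the two
indices sum to at least `p`, so either both are at least `p / 3` or one exceeds `2p / 3`. -/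
theorem sq_dvd_coeff_sub {p : ℕ} (hp : p.Prime) (m : ℕ) :
    (p : ℤ) ^ 2 ∣ (∑ k ∈ range p, C (((2 * k).choose k ^ 2 * (3 * k).choose k : ℕ) : ℤ) *
      (X * (1 - 27 * X)) ^ k - (∑ k ∈ range p, C (((2 * k).choose k * (3 * k).choose k : ℕ) : ℤ) *
        X ^ k) ^ 2 : ℤ[X]).coeff m := by
  have hB : ∀ i, (∑ k ∈ range p, C (((2 * k).choose k * (3 * k).choose k : ℕ) : ℤ) * X ^ k :
      ℤ[X]).coeff i = if i < p then (((2 * i).choose i * (3 * i).choose i : ℕ) : ℤ) else 0 := by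
    intro i
    simp only [finsetSum_coeff, coeff_C_mul_X_pow]
    simp
  rcases lt_or_ge m p with hm | hm
  · obtain ⟨K, rfl⟩ : ∃ K, p = K + 1 := ⟨p - 1, by have := hp.pos; omega⟩
    have h := coeff_sum_clausenArg K m (by omega)
    have h2 : (((∑ k ∈ range (K + 1), C (((2 * k).choose k ^ 2 * (3 * k).choose k : ℕ) : ℤ) *
      (X * (1 - 27 * X)) ^ k : ℤ[X]).map (Int.castRingHom ℚ) : ℚ[X]) : PowerSeries ℚ) =
      ∑ k ∈ range (K + 1),
      PowerSeries.C (((2 * k).choose k ^ 2 * (3 * k).choose k : ℕ) : ℚ) * clausenArg ^ k := by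
      simp only [Polynomial.map_sum, ← coeToPowerSeries.ringHom_apply, map_sum]
      refine sum_congr rfl fun k _ => ?_
      have h27 : ((27 : ℚ[X]) : PowerSeries ℚ) = 27 := map_ofNat coeToPowerSeries.ringHom 27
      have hn (n : ℕ) : ((n : ℚ[X]) : PowerSeries ℚ) = n := map_natCast coeToPowerSeries.ringHom n
      simp [coeToPowerSeries.ringHom_apply, clausenArg, h27, hn]
      left
      ring
    rw [← h2, coeff_coe, coeff_map] at h
    refine (dvd_zero _).trans (Eq.dvd (Eq.symm ?_))
    rw [coeff_sub, sub_eq_zero]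
    have h3 : Function.Injective (Int.castRingHom ℚ) := Int.cast_injective
    apply h3
    rw [h, sq, sq, PowerSeries.coeff_mul, coeff_mul, map_sum]
    refine sum_congr rfl fun ij hij => ?_
    have hij' := mem_antidiagonal.1 hij
    rw [hB, hB, if_pos (by omega), if_pos (by omega)]
    simp [cubicSeries]
  · rw [coeff_sub]
    refine dvd_sub ?_ ?_
    · rw [finsetSum_coeff]
      refine dvd_sum fun k hk => ?_
      rw [coeff_C_mul]
      rcases le_or_gt p (2 * k) with h | h
      · refine Dvd.dvd.mul_right ?_ _
        exact_mod_cast sq_dvd_choose_sq_mul_choose hp h (mem_range.1 hk)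
      · rw [coeff_eq_zero_of_natDegree_lt, mul_zero]
        · exact dvd_zero _
        · refine lt_of_le_of_lt natDegree_pow_le ?_
          have : (X * (1 - 27 * X) : ℤ[X]).natDegree ≤ 2 := by compute_degree
          nlinarith
    · rw [sq (∑ k ∈ range p, _), coeff_mul]
      refine dvd_sum fun ij hij => ?_
      have hij' := mem_antidiagonal.1 hij
      rw [hB, hB]
      split_ifs with h1 h2
      · by_cases h3 : 3 * ij.1 < p
        · refine Dvd.dvd.mul_left ?_ _
          exact_mod_cast sq_dvd_choose_mul_choose hp (by omega) h2
        · by_cases h4 : 3 * ij.2 < p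
          · refine Dvd.dvd.mul_right ?_ _
            exact_mod_cast sq_dvd_choose_mul_choose hp (by omega) h1
          · rw [sq]
            refine mul_dvd_mul ?_ ?_
            · exact_mod_cast dvd_choose_mul_choose hp (by omega) h1
            · exact_mod_cast dvd_choose_mul_choose hp (by omega) h2
      all_goals simp

theorem sum_clausen_eq_sq {p : ℕ} (hp : p.Prime) {R : Type*} [CommRing R] (hR : (p : R) ^ 2 = 0)
    (x : R) :
    ∑ k ∈ range p, (((2 * k).choose k ^ 2 * (3 * k).choose k : ℕ) : R) * (x * (1 - 27 * x)) ^ k =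
      (∑ k ∈ range p, (((2 * k).choose k * (3 * k).choose k : ℕ) : R) * x ^ k) ^ 2 := by
  obtain ⟨Q, hQ⟩ := C_dvd_iff_dvd_coeff _ _ |>.2 (sq_dvd_coeff_sub hp)
  have h := congrArg (aeval x) hQ
  have hz : aeval x (C ((p : ℤ) ^ 2)) = 0 := by
    simp [hR]
  rw [map_mul, hz, zero_mul] at h
  have h27 : aeval x (27 : ℤ[X]) = 27 := map_ofNat _ 27
  rw [← sub_eq_zero, ← h]
  simp [h27]

/-! ### A character sum over the Gaussian extension -/

/-- The algebra `F[i]` with `i² = -1`. It is a field or a product of two copies of `F`; both cases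
are treated together, `z` being a unit exactly when its norm is nonzero. -/
abbrev GaussianExt (F : Type*) [Field F] := QuadraticAlgebra F (-1) 0

section OcticSum
open scoped QuadraticAlgebra
variable {F : Type*} [Field F] [Fintype F] [DecidableEq F]

instance : Fintype (GaussianExt F) :=
  Fintype.ofEquiv (F × F) (QuadraticAlgebra.equivProd (-1 : F) 0).symm

local notation "χ" => quadraticChar F
local notation "𝒩" => QuadraticAlgebra.norm (R := F) (a := -1) (b := 0)

theorem GaussianExt.norm_eq {F : Type*} [Field F] (z : GaussianExt F) :
    QuadraticAlgebra.norm z = z.re ^ 2 + z.im ^ 2 := by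
  rw [QuadraticAlgebra.norm_def]; ring

theorem GaussianExt.sum_eq (f : GaussianExt F → ℤ) : ∑ z, f z = ∑ x, ∑ y, f ⟨x, y⟩ := by
  rw [← Fintype.sum_prod_type' (f := fun x y => f ⟨x, y⟩)]
  exact Fintype.sum_equiv (QuadraticAlgebra.equivProd (-1 : F) 0) _ _ fun _ => rfl

theorem GaussianExt.sum_mul_left {b : GaussianExt F} (hb : 𝒩 b ≠ 0) (f : GaussianExt F → ℤ) :
    ∑ z, f (b * z) = ∑ z, f z := by
  obtain ⟨u, rfl⟩ := QuadraticAlgebra.isUnit_iff_norm_isUnit.2 hb.isUnit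
  exact Equiv.sum_comp (Units.mulLeft u) f

/-- The sum `T(a) = ∑_z χ(N z) χ(Re(a z⁴))` over `F[i]`. Non-units contribute zero. -/
def octicSum (a : GaussianExt F) : ℤ := ∑ z : GaussianExt F, χ (𝒩 z) * χ (a * z ^ 4).re

theorem octicSum_smul (l : F) (a : GaussianExt F) : octicSum (l • a) = χ l * octicSum a := by
  unfold octicSum
  rw [mul_sum]
  refine sum_congr rfl fun z _ => ?_
  rw [smul_mul_assoc, QuadraticAlgebra.re_smul, smul_eq_mul, map_mul]
  ring

theorem octicSum_mul_pow_four (a : GaussianExt F) {b : GaussianExt F} (hb : 𝒩 b ≠ 0) :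
    octicSum (a * b ^ 4) = χ (𝒩 b) * octicSum a := by
  have h : octicSum a = χ (𝒩 b) * octicSum (a * b ^ 4) := by
    unfold octicSum
    rw [← GaussianExt.sum_mul_left hb, mul_sum]
    refine sum_congr rfl fun z _ => ?_
    rw [map_mul, map_mul, mul_pow]
    ring_nf
  have h1 : χ (𝒩 b) * χ (𝒩 b) = 1 := by rw [← sq]; exact quadraticChar_sq_one hb
  rw [h, ← mul_assoc, h1, one_mul]

theorem octicSum_star (a : GaussianExt F) : octicSum (star a) = octicSum a := by
  unfold octicSum
  have : ∀ z : GaussianExt F, (star a * star z ^ 4).re = (a * z ^ 4).re := fun z => by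
    rw [← star_pow, ← star_mul', QuadraticAlgebra.re_star]
    ring
  rw [← Equiv.sum_comp (starRingAut (R := GaussianExt F)).toEquiv]
  refine sum_congr rfl fun z _ => ?_
  have h := this z
  have h2 := QuadraticAlgebra.norm_star z
  simp only [RingEquiv.toEquiv_eq_coe, EquivLike.coe_coe, starRingAut_apply]
  rw [h, h2]

/-- The element `b = 1 + i` has norm `2` and `b⁴ = -4`. -/
theorem octicSum_one_of_neg_two (hF : ringChar F ≠ 2) (h : χ (-2) = -1) :
    octicSum (1 : GaussianExt F) = 0 := by
  have h2 : (2 : F) ≠ 0 := Ring.two_ne_zero hF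
  have hN : 𝒩 (⟨1, 1⟩ : GaussianExt F) = 2 := by rw [GaussianExt.norm_eq]; norm_num
  have e := octicSum_mul_pow_four (1 : GaussianExt F) (b := ⟨1, 1⟩) (by rwa [hN])
  have e2 : (1 : GaussianExt F) * ⟨1, 1⟩ ^ 4 = (-1 * 2 ^ 2 : F) • 1 := by
    ext <;> simp [pow_succ] <;> norm_num
  rw [e2, octicSum_smul, hN, map_mul, map_pow, quadraticChar_sq_one h2] at e
  rw [show (-2 : F) = -1 * 2 by ring, map_mul] at h
  have h3 : χ 2 * χ 2 = 1 := by rw [← sq]; exact quadraticChar_sq_one h2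
  have : octicSum (1 : GaussianExt F) = χ (-1) * χ 2 * octicSum (1 : GaussianExt F) := by
    linear_combination (-χ 2) * e - octicSum (1 : GaussianExt F) * h3
  rw [h] at this
  omega

/-- The sum `octicSum` taken over the projective line instead of over all of `F[i]`: the summand
is invariant under scaling `z` by `Fˣ`. The first term is the point at infinity `z = 1`. -/
def octicLineSum (a : GaussianExt F) : ℤ :=
  χ a.re + ∑ t : F, χ (t ^ 2 + 1) * χ (a * (⟨t, 1⟩ : GaussianExt F) ^ 4).re

theorem octicSum_eq_octicLineSum (a : GaussianExt F) :
    octicSum a = (Fintype.card F - 1 : ℤ) * octicLineSum a := by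
  unfold octicSum octicLineSum
  have h1 : ∀ (y t : F), y ≠ 0 → χ (𝒩 (⟨y * t, y⟩ : GaussianExt F)) *
      χ (a * (⟨y * t, y⟩ : GaussianExt F) ^ 4).re =
        χ (t ^ 2 + 1) * χ (a * (⟨t, 1⟩ : GaussianExt F) ^ 4).re := by
    intro y t hy
    have e : (⟨y * t, y⟩ : GaussianExt F) = y • (⟨t, 1⟩ : GaussianExt F) := by ext <;> simp
    rw [GaussianExt.norm_eq, e, _root_.smul_pow, mul_smul_comm, QuadraticAlgebra.re_smul]
    simp only [QuadraticAlgebra.re_smul, QuadraticAlgebra.im_smul, smul_eq_mul]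
    rw [show (y * t) ^ 2 + (y * 1) ^ 2 = y ^ 2 * (t ^ 2 + 1) by ring, map_mul, map_mul, map_pow,
      map_pow, show 4 = 2 * 2 from rfl, pow_mul, quadraticChar_sq_one hy]
    ring
  have h0 : ∀ x : F, x ≠ 0 → χ (𝒩 (⟨x, 0⟩ : GaussianExt F)) *
      χ (a * (⟨x, 0⟩ : GaussianExt F) ^ 4).re = χ a.re := by
    intro x hx
    have e : (⟨x, 0⟩ : GaussianExt F) = x • 1 := by ext <;> simp
    rw [GaussianExt.norm_eq, e, _root_.smul_pow, mul_smul_comm, QuadraticAlgebra.re_smul]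
    simp only [QuadraticAlgebra.re_smul, QuadraticAlgebra.im_smul, smul_eq_mul, one_pow, mul_one]
    rw [map_mul, map_pow, show 4 = 2 * 2 from rfl, pow_mul, quadraticChar_sq_one hx]
    simp [quadraticChar_sq_one' hx]
  rw [GaussianExt.sum_eq, sum_comm, Fintype.sum_eq_add_sum_compl 0, mul_add]
  have hc : (({0}ᶜ : Finset F).card : ℤ) = Fintype.card F - 1 := by
    rw [card_compl, card_singleton, Nat.cast_sub Fintype.card_pos, Nat.cast_one]
  congr 1
  · rw [Fintype.sum_eq_add_sum_compl 0,
      sum_congr rfl fun x hx => h0 x (by simpa [mem_compl] using hx)]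
    simp [hc, GaussianExt.norm_eq]
  · rw [sum_congr rfl fun y hy => (?_ : _ =
        ∑ t : F, χ (t ^ 2 + 1) * χ (a * (⟨t, 1⟩ : GaussianExt F) ^ 4).re)]
    · rw [sum_const, nsmul_eq_mul, hc]
    · have hy : y ≠ 0 := by simpa using hy
      rw [← Equiv.sum_comp (Equiv.mulLeft₀ y hy)]
      exact sum_congr rfl fun t _ => h1 y t hy

/-- The linear forms `Re a` and `Re(a v)` are proportional exactly when `v` is a scalar; otherwise
the inner sum of `χ` runs over all of `F` and vanishes. -/
theorem sum_quadraticChar_re_mul (hF : ringChar F ≠ 2) (v : GaussianExt F) :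
    ∑ a : GaussianExt F, χ a.re * χ (a * v).re =
      if v.im = 0 then χ v.re * (Fintype.card F * (Fintype.card F - 1)) else 0 := by
  rw [GaussianExt.sum_eq]
  have e : ∀ x y : F, ((⟨x, y⟩ : GaussianExt F) * v).re = x * v.re - y * v.im := fun x y => by
    simp; ring
  simp only [e]
  split_ifs with h
  · simp only [h, mul_zero, sub_zero, map_mul, sum_const, card_univ, nsmul_eq_mul]
    rw [← mul_sum, ← one_mul (∑ x : F, _)]
    have : ∑ x : F, χ x * (χ x * χ v.re) = (Fintype.card F - 1) * χ v.re := by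
      rw [Fintype.sum_eq_add_sum_compl 0, sum_congr rfl fun x hx => (?_ : _ = χ v.re)]
      · rw [sum_const, card_compl, card_singleton, nsmul_eq_mul, Nat.cast_sub Fintype.card_pos]
        simp
      · rw [← mul_assoc, ← sq, quadraticChar_sq_one (by simpa using hx), one_mul]
    rw [this]; ring
  · refine sum_eq_zero fun x _ => ?_
    rw [← mul_sum]
    have : ∑ y : F, χ (x * v.re - y * v.im) = ∑ y : F, χ y :=
      Equiv.sum_comp ((Equiv.mulRight₀ v.im h).trans (Equiv.subLeft (x * v.re))) fun y => χ y
    rw [this, quadraticChar_sum_zero hF, mul_zero]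

/-- The elements `y` with `y⁴` a scalar lie on the four lines spanned by `1`, `i` and `1 ± i`. On
each of them the summand is the constant `q (q - 1)`; for `1 ± i` this uses `χ(-2) = 1`. -/
theorem sum_norm_pow_four (hF : ringChar F ≠ 2) (h : χ (-2) = 1) :
    ∑ y : GaussianExt F, χ (𝒩 y) * (if (y ^ 4).im = 0 then
      χ (y ^ 4).re * (Fintype.card F * (Fintype.card F - 1) : ℤ) else 0) =
      4 * Fintype.card F * (Fintype.card F - 1) ^ 2 := by
  have h2 : (2 : F) ≠ 0 := Ring.two_ne_zero hF
  set c : ℤ := Fintype.card F * (Fintype.card F - 1) with hc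
  have hre : ∀ x y : F, ((⟨x, y⟩ : GaussianExt F) ^ 4).re = x ^ 4 - 6 * x ^ 2 * y ^ 2 + y ^ 4 :=
    fun x y => by simp [pow_succ]; ring
  have him : ∀ x y : F, ((⟨x, y⟩ : GaussianExt F) ^ 4).im = 2 ^ 2 * x * y * ((x - y) * (x + y)) :=
    fun x y => by simp [pow_succ]; ring
  rw [GaussianExt.sum_eq]
  simp only [GaussianExt.norm_eq, hre, him]
  have hp4 : ∀ x : F, x ≠ 0 → χ (x ^ 4) = 1 := fun x hx => by
    rw [show x ^ 4 = (x ^ 2) ^ 2 by ring]; exact quadraticChar_sq_one' (pow_ne_zero _ hx)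
  have h0 : ∀ y : F, y ≠ 0 → χ ((0 : F) ^ 2 + y ^ 2) *
      (if 2 ^ 2 * 0 * y * ((0 - y) * (0 + y)) = 0 then
      χ ((0 : F) ^ 4 - 6 * 0 ^ 2 * y ^ 2 + y ^ 4) * c else 0) = c := fun y hy => by
    rw [if_pos (by ring), show (0 : F) ^ 2 + y ^ 2 = y ^ 2 by ring,
      show (0 : F) ^ 4 - 6 * 0 ^ 2 * y ^ 2 + y ^ 4 = y ^ 4 by ring, hp4 y hy,
      quadraticChar_sq_one' hy, one_mul, one_mul]
  have h3 : ∀ x : F, x ≠ 0 → ∑ y : F, χ (x ^ 2 + y ^ 2) *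
      (if 2 ^ 2 * x * y * ((x - y) * (x + y)) = 0 then
      χ (x ^ 4 - 6 * x ^ 2 * y ^ 2 + y ^ 4) * c else 0) = 3 * c := fun x hx => by
    have hx' : x ≠ -x := fun e => hx (by
      have : 2 * x = 0 := by linear_combination e
      simpa [h2] using this)
    have hm : χ (2 * x ^ 2) * χ (-2 ^ 2 * x ^ 4) = 1 := by
      rw [← map_mul, show 2 * x ^ 2 * (-2 ^ 2 * x ^ 4) = -2 * (2 * x ^ 3) ^ 2 by ring, map_mul, h,
        quadraticChar_sq_one' (mul_ne_zero h2 (pow_ne_zero _ hx)), one_mul]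
    rw [← sum_subset (subset_univ {0, x, -x}), sum_insert, sum_insert, sum_singleton]
    · rw [if_pos (by ring), if_pos (by ring), if_pos (by ring),
        show x ^ 2 + 0 ^ 2 = x ^ 2 by ring, show x ^ 4 - 6 * x ^ 2 * 0 ^ 2 + 0 ^ 4 = x ^ 4 by ring,
        show x ^ 2 + x ^ 2 = 2 * x ^ 2 by ring, show x ^ 2 + (-x) ^ 2 = 2 * x ^ 2 by ring,
        show x ^ 4 - 6 * x ^ 2 * x ^ 2 + x ^ 4 = -2 ^ 2 * x ^ 4 by ring,
        show x ^ 4 - 6 * x ^ 2 * (-x) ^ 2 + (-x) ^ 4 = -2 ^ 2 * x ^ 4 by ring,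
        hp4 x hx, quadraticChar_sq_one' hx]
      linear_combination (2 * c) * hm
    · simpa using hx'
    · simpa [eq_comm] using hx
    · intro y _ hy
      simp only [mem_insert, mem_singleton, not_or] at hy
      rw [if_neg, mul_zero]
      refine mul_ne_zero (mul_ne_zero (mul_ne_zero (pow_ne_zero _ h2) hx) hy.1)
        (mul_ne_zero (sub_ne_zero.2 (Ne.symm hy.2.1)) ?_)
      exact fun e => hy.2.2 (by linear_combination e)
  have hcard : (({0}ᶜ : Finset F).card : ℤ) = Fintype.card F - 1 := by
    rw [card_compl, card_singleton, Nat.cast_sub Fintype.card_pos, Nat.cast_one]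
  rw [Fintype.sum_eq_add_sum_compl 0,
    sum_congr rfl fun x hx => h3 x (by simpa [mem_compl] using hx),
    Fintype.sum_eq_add_sum_compl 0, sum_congr rfl fun x hx => h0 x (by simpa [mem_compl] using hx),
    sum_const, sum_const, nsmul_eq_mul, nsmul_eq_mul, hcard]
  simp
  rw [hc]; ring

/-- The second moment of `octicSum`: opening the square and substituting `z' = z y`, only the
pairs with `y⁴` a scalar survive. -/
theorem sum_sq_octicSum (hF : ringChar F ≠ 2) (h : χ (-2) = 1) :
    ∑ a : GaussianExt F, octicSum a ^ 2 =
      (∑ z : GaussianExt F, χ (𝒩 z) ^ 2) * (4 * Fintype.card F * (Fintype.card F - 1) ^ 2) := by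
  have e1 : ∑ a : GaussianExt F, octicSum a ^ 2 = ∑ z : GaussianExt F, χ (𝒩 z) *
      ∑ y : GaussianExt F, χ (𝒩 y) * ∑ a : GaussianExt F, χ (a * z ^ 4).re * χ (a * y ^ 4).re := by
    simp only [octicSum, sq, sum_mul_sum]
    rw [sum_comm]
    refine sum_congr rfl fun z _ => ?_
    rw [sum_comm, mul_sum]
    refine sum_congr rfl fun y _ => ?_
    rw [mul_sum, mul_sum]
    refine sum_congr rfl fun a _ => ?_
    ring
  rw [e1, sum_mul]
  refine sum_congr rfl fun z _ => ?_
  by_cases hz : 𝒩 z = 0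
  · rw [hz, MulChar.map_zero]; ring
  have hz4 : 𝒩 (z ^ 4) ≠ 0 := by rw [map_pow]; exact pow_ne_zero _ hz
  rw [← sum_norm_pow_four hF h, sq, mul_assoc]
  congr 1
  rw [← GaussianExt.sum_mul_left hz, mul_sum]
  refine sum_congr rfl fun y _ => ?_
  rw [← sum_quadraticChar_re_mul hF, map_mul, map_mul, mul_assoc]
  congr 2
  conv_rhs => rw [← GaussianExt.sum_mul_left hz4]
  refine sum_congr rfl fun a _ => ?_
  rw [mul_pow, mul_comm a, mul_left_comm, mul_comm a, mul_assoc, mul_comm a, mul_left_comm]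

theorem GaussianExt.exists_norm_eq (hF : ringChar F ≠ 2) (c : F) :
    ∃ z : GaussianExt F, 𝒩 z = c := by
  obtain ⟨x, y, h⟩ := FiniteField.exists_root_sum_quadratic (f := X ^ 2) (g := X ^ 2 - C c)
    (degree_X_pow 2) (degree_X_pow_sub_C two_pos c) (FiniteField.odd_card_of_char_ne_two hF)
  refine ⟨⟨x, y⟩, ?_⟩
  rw [GaussianExt.norm_eq]
  simp only [eval_pow, eval_X, eval_sub, eval_C] at h
  linear_combination h

/-- A non-unit `a` is an eigenvector of multiplication by any `b`, so that `T(a b⁴) = T(a)`;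
choosing `χ(N b) = -1` gives `T(a) = -T(a)`. -/
theorem octicSum_eq_zero_of_norm (hF : ringChar F ≠ 2) {a : GaussianExt F} (ha : 𝒩 a = 0) :
    octicSum a = 0 := by
  rw [GaussianExt.norm_eq] at ha
  by_cases h0 : a.re = 0
  · have h1 : a.im = 0 := by simpa [h0] using ha
    have : a = 0 := by ext <;> simpa
    simp [octicSum, this]
  obtain ⟨c, hc⟩ := quadraticChar_exists_neg_one hF
  obtain ⟨b, rfl⟩ := GaussianExt.exists_norm_eq hF c
  -- In the split case `a` spans the line where `i` acts as the scalar `-j`.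
  obtain ⟨j, hj⟩ : ∃ j, a.im = j * a.re := ⟨a.im / a.re, by field_simp⟩
  have hj2 : j ^ 2 = -1 := by
    have : a.re ^ 2 * (j ^ 2 + 1) = 0 := by
      rw [hj] at ha
      linear_combination ha
    have := (mul_eq_zero.1 this).resolve_left (pow_ne_zero _ h0)
    linear_combination this
  have hb : 𝒩 b ≠ 0 := fun e => by rw [e] at hc; simp at hc
  set m := b.re - j * b.im with hm
  have hm0 : m ≠ 0 := fun e => hb (by
    rw [GaussianExt.norm_eq]
    linear_combination (b.re + j * b.im) * e + (b.re + j * b.im) * hm + b.im ^ 2 * hj2)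
  have hab : a * b = m • a := by
    ext
    · simp [hj, hm]; ring
    · simp [hj, hm]; linear_combination (a.re * b.im) * hj2
  have hab4 : a * b ^ 4 = ((m ^ 2) ^ 2) • a := by
    calc a * b ^ 4 = a * b * b * b * b := by ring
      _ = _ := by
        simp only [hab, smul_mul_assoc, smul_smul]
        congr 1; ring
  have := octicSum_mul_pow_four a hb
  rw [hab4, octicSum_smul, hc, quadraticChar_sq_one' (pow_ne_zero _ hm0)] at this
  omega

/-- A form of Hilbert's Theorem 90: an element whose norm is a nonzero square is a scalar times
the square of a unit. If `N a = n²` then `(a + n)² = 2 (Re a + n) a`. -/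
theorem GaussianExt.exists_eq_smul_sq (hF : ringChar F ≠ 2) {a : GaussianExt F} (ha : χ (𝒩 a) = 1) :
    ∃ (l : F) (b : GaussianExt F), l ≠ 0 ∧ 𝒩 b ≠ 0 ∧ a = l • b ^ 2 := by
  have h2 : (2 : F) ≠ 0 := Ring.two_ne_zero hF
  have ha0 : 𝒩 a ≠ 0 := fun e => by rw [e] at ha; simp at ha
  obtain ⟨n, hn⟩ := (quadraticChar_one_iff_isSquare ha0).1 ha
  have hn0 : n ≠ 0 := fun e => ha0 (by rw [hn, e, mul_zero])
  rw [GaussianExt.norm_eq] at hn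
  -- When `a + n` fails to be a unit, `a` is itself a scalar.
  by_cases hr : a.re + n = 0
  · have him : a.im = 0 := by
      have : a.im ^ 2 = 0 := by linear_combination hn - (a.re - n) * hr
      simpa using this
    refine ⟨a.re, 1, fun e => hn0 (by linear_combination hr - e), by simp, ?_⟩
    ext <;> simp [him]
  · refine ⟨(2 * (a.re + n))⁻¹, ⟨a.re + n, a.im⟩, inv_ne_zero (mul_ne_zero h2 hr), ?_, ?_⟩
    · rw [GaussianExt.norm_eq]
      have : (a.re + n) ^ 2 + a.im ^ 2 = 2 * n * (a.re + n) := by linear_combination hn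
      simp only [this]
      exact mul_ne_zero (mul_ne_zero h2 hn0) hr
    · have hne := mul_ne_zero h2 hr
      ext
      · simp only [sq, QuadraticAlgebra.re_smul, QuadraticAlgebra.re_mul, smul_eq_mul]
        rw [eq_inv_mul_iff_mul_eq₀ hne]
        linear_combination hn
      · simp only [sq, QuadraticAlgebra.im_smul, QuadraticAlgebra.im_mul, smul_eq_mul]
        rw [eq_inv_mul_iff_mul_eq₀ hne]
        ring

theorem octicSum_sq_of_norm (hF : ringChar F ≠ 2) {z : GaussianExt F} (hz : χ (𝒩 z) = 1)
    (a : GaussianExt F) : octicSum (a * z ^ 2) ^ 2 = octicSum a ^ 2 := by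
  obtain ⟨l, b, hl, hb, rfl⟩ := GaussianExt.exists_eq_smul_sq hF hz
  have : a * (l • b ^ 2) ^ 2 = (l ^ 2) • (a * b ^ 4) := by
    rw [_root_.smul_pow, mul_smul_comm]; congr 2; ring
  rw [this, octicSum_smul, octicSum_mul_pow_four a hb, mul_pow, mul_pow, quadraticChar_sq_one hb,
    quadraticChar_sq_one (pow_ne_zero _ hl), one_mul, one_mul]

theorem GaussianExt.self_mul_star (z : GaussianExt F) : z * star z = (𝒩 z) • 1 := by
  rw [← QuadraticAlgebra.algebraMap_norm_eq_mul_star, Algebra.algebraMap_eq_smul_one]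

/-- Conjugation fixes `T`, and `star (z²) * z⁴` is a scalar square times `z²`, so that
`T(z²) = χ(N z) T(z²)`. -/
theorem octicSum_sq_eq_zero_of_norm {z : GaussianExt F} (hz : χ (𝒩 z) = -1) :
    octicSum (z ^ 2) = 0 := by
  have hz0 : 𝒩 z ≠ 0 := fun e => by rw [e] at hz; simp at hz
  have e : star (z ^ 2) * z ^ 4 = ((𝒩 z) ^ 2) • z ^ 2 := by
    calc star (z ^ 2) * z ^ 4 = (z * star z) ^ 2 * z ^ 2 := by rw [star_pow]; ring
      _ = _ := by rw [GaussianExt.self_mul_star, _root_.smul_pow, one_pow, smul_mul_assoc, one_mul]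
  have h1 := octicSum_mul_pow_four (star (z ^ 2)) hz0
  rw [e, octicSum_smul, quadraticChar_sq_one' hz0, octicSum_star, hz] at h1
  omega

/-- On the elements whose norm is a non-square, `T²` is constant: such elements differ by a scalar
times a square `b²`, and the case `χ(N b) = -1` is reduced to the other one by conjugating `g`. -/
theorem octicSum_sq_eq (hF : ringChar F ≠ 2) {a g : GaussianExt F} (ha : χ (𝒩 a) = -1)
    (hg : χ (𝒩 g) = -1) : octicSum a ^ 2 = octicSum g ^ 2 := by
  have hg0 : 𝒩 g ≠ 0 := fun e => by rw [e] at hg; simp at hg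
  obtain ⟨l, b, hl, hb, hv⟩ := GaussianExt.exists_eq_smul_sq hF (a := a * star g)
    (by rw [map_mul, map_mul, ha, QuadraticAlgebra.norm_star, hg]; rfl)
  have hag : (𝒩 g) • a = l • (g * b ^ 2) := by
    calc (𝒩 g) • a = a * (g * star g) := by rw [GaussianExt.self_mul_star]; simp
      _ = a * star g * g := by ring
      _ = _ := by rw [hv, smul_mul_assoc, mul_comm]
  have e0 : octicSum a ^ 2 = octicSum (g * b ^ 2) ^ 2 := by
    have := congrArg (fun x => octicSum x ^ 2) hag
    simpa only [octicSum_smul, mul_pow, quadraticChar_sq_one hl, quadraticChar_sq_one hg0,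
      one_mul] using this
  rw [e0]
  rcases quadraticChar_dichotomy hb with h | h
  · exact octicSum_sq_of_norm hF h g
  · have h1 : χ (𝒩 (g * b)) = 1 := by rw [map_mul, map_mul, hg, h]; rfl
    have e : (𝒩 g) • (g * b ^ 2) = star g * (g * b) ^ 2 := by
      calc (𝒩 g) • (g * b ^ 2) = (g * star g) * (g * b ^ 2) := by
              rw [GaussianExt.self_mul_star]; simp
        _ = _ := by ring
    have := congrArg (fun x => octicSum x ^ 2) e
    simp only [octicSum_smul, octicSum_sq_of_norm hF h1, octicSum_star] at this
    rwa [mul_pow, quadraticChar_sq_one hg0, one_mul] at this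

theorem GaussianExt.sum_norm_eq_one {g : GaussianExt F} (hg : χ (𝒩 g) = -1)
    (f : GaussianExt F → ℤ) : ∑ a : GaussianExt F, (if χ (𝒩 a) = -1 then f a else 0) =
      ∑ a : GaussianExt F, (if χ (𝒩 a) = 1 then f (g * a) else 0) := by
  have hg0 : 𝒩 g ≠ 0 := fun e => by rw [e] at hg; simp at hg
  rw [← GaussianExt.sum_mul_left hg0]
  refine sum_congr rfl fun a _ => ?_
  simp only [map_mul, hg, neg_mul, one_mul, neg_inj]

/-- The second moment, split according to `χ(N a)`. The part with `χ(N a) = 1` is averaged over the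
translates `a z²`, of which half have `T² = T(1)²` and half have `T = 0`. -/
theorem octicSum_one_sq_add (hF : ringChar F ≠ 2) (h : χ (-2) = 1) {g : GaussianExt F}
    (hg : χ (𝒩 g) = -1) : octicSum (1 : GaussianExt F) ^ 2 + 2 * octicSum g ^ 2 =
      16 * Fintype.card F * (Fintype.card F - 1) ^ 2 := by
  set m : ℤ := ∑ a : GaussianExt F, (if χ (𝒩 a) = 1 then 1 else 0) with hm
  have hm' : ∑ a : GaussianExt F, (if χ (𝒩 a) = -1 then 1 else 0) = m :=
    GaussianExt.sum_norm_eq_one hg _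
  have hm0 : 0 < m := by
    refine sum_pos' (fun a _ => ?_) ⟨1, mem_univ _, ?_⟩
    · split_ifs <;> norm_num
    · rw [map_one, map_one, if_pos rfl]; exact one_pos
  have hsplit : ∀ f : GaussianExt F → ℤ, ∑ a : GaussianExt F, χ (𝒩 a) ^ 2 * f a =
      ∑ a : GaussianExt F, (if χ (𝒩 a) = 1 then f a else 0) +
        ∑ a : GaussianExt F, (if χ (𝒩 a) = -1 then f a else 0) := fun f => by
    rw [← sum_add_distrib]
    refine sum_congr rfl fun a _ => ?_
    by_cases h0 : 𝒩 a = 0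
    · simp [h0]
    · rcases quadraticChar_dichotomy h0 with h | h <;> simp [h]
  have hM : ∑ a : GaussianExt F, χ (𝒩 a) ^ 2 = 2 * m := by
    have := hsplit fun _ => 1
    rw [hm', ← hm] at this
    simp only [mul_one] at this
    rw [this]; ring
  have hT : ∑ a : GaussianExt F, octicSum a ^ 2 =
      ∑ a : GaussianExt F, χ (𝒩 a) ^ 2 * octicSum a ^ 2 := by
    refine sum_congr rfl fun a _ => ?_
    by_cases h0 : 𝒩 a = 0
    · rw [octicSum_eq_zero_of_norm hF h0]; simp
    · rw [quadraticChar_sq_one h0, one_mul]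
  have hQ' : ∑ a : GaussianExt F, (if χ (𝒩 a) = -1 then octicSum a ^ 2 else 0) =
      m * octicSum g ^ 2 := by
    rw [← hm', sum_mul]
    refine sum_congr rfl fun a _ => ?_
    split_ifs with ha
    · rw [octicSum_sq_eq hF ha hg, one_mul]
    · rw [zero_mul]
  have hsq : ∑ z : GaussianExt F, χ (𝒩 z) ^ 2 * octicSum (z ^ 2) ^ 2 =
      m * octicSum (1 : GaussianExt F) ^ 2 := by
    rw [hm, sum_mul]
    refine sum_congr rfl fun z _ => ?_
    by_cases h0 : 𝒩 z = 0
    · simp [h0]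
    · rcases quadraticChar_dichotomy h0 with h | h
      · rw [← one_mul (z ^ 2), octicSum_sq_of_norm hF h]
        simp [h]
      · rw [octicSum_sq_eq_zero_of_norm h]
        simp [h]
  have hQ : 2 * m * ∑ a : GaussianExt F, (if χ (𝒩 a) = 1 then octicSum a ^ 2 else 0) =
      m * (m * octicSum (1 : GaussianExt F) ^ 2) := by
    have e1 : ∀ z : GaussianExt F, χ (𝒩 z) ^ 2 * (∑ a : GaussianExt F,
        (if χ (𝒩 a) = 1 then octicSum a ^ 2 else 0)) = ∑ a : GaussianExt F,
        (if χ (𝒩 a) = 1 then χ (𝒩 z) ^ 2 * octicSum (a * z ^ 2) ^ 2 else 0) := fun z => by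
      by_cases h0 : 𝒩 z = 0
      · simp [h0]
      · have hz2 : 𝒩 (z ^ 2) ≠ 0 := by rw [map_pow]; exact pow_ne_zero _ h0
        rw [← GaussianExt.sum_mul_left hz2, quadraticChar_sq_one h0, one_mul]
        refine sum_congr rfl fun a _ => ?_
        rw [map_mul, map_pow, map_mul, quadraticChar_sq_one' h0, one_mul, one_mul, mul_comm a]
    rw [← hM, sum_mul, sum_congr rfl fun z _ => e1 z, sum_comm, hm, sum_mul]
    refine sum_congr rfl fun a _ => ?_
    split_ifs with ha
    · obtain ⟨l, b, hl, hb, rfl⟩ := GaussianExt.exists_eq_smul_sq hF ha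
      rw [one_mul, ← hm, ← hsq]
      conv_rhs => rw [← GaussianExt.sum_mul_left hb]
      refine sum_congr rfl fun z _ => ?_
      rw [smul_mul_assoc, octicSum_smul, mul_pow (χ l), quadraticChar_sq_one hl, one_mul,
        mul_pow b z, map_mul, map_mul, mul_pow, quadraticChar_sq_one hb, one_mul]
    · simp
  have h1 := sum_sq_octicSum hF h
  rw [hT, hsplit, hQ', hM] at h1
  have h2 : (m * m) * (octicSum (1 : GaussianExt F) ^ 2 + 2 * octicSum g ^ 2) =
      (m * m) * (16 * Fintype.card F * (Fintype.card F - 1) ^ 2) := by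
    linear_combination 2 * m * h1 - hQ
  exact mul_left_cancel₀ (mul_pos hm0 hm0).ne' h2

theorem octicLineSum_one_sq_add (hF : ringChar F ≠ 2) (h : χ (-2) = 1) :
    ∃ y : ℤ, octicLineSum (1 : GaussianExt F) ^ 2 + 2 * y ^ 2 = 16 * Fintype.card F := by
  obtain ⟨c, hc⟩ := quadraticChar_exists_neg_one hF
  obtain ⟨g, rfl⟩ := GaussianExt.exists_norm_eq hF c
  refine ⟨octicLineSum g, ?_⟩
  have h1 := octicSum_one_sq_add hF h hc
  rw [octicSum_eq_octicLineSum, octicSum_eq_octicLineSum] at h1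
  have hq : (Fintype.card F : ℤ) - 1 ≠ 0 := by
    have := Fintype.one_lt_card (α := F)
    omega
  refine mul_left_cancel₀ (pow_ne_zero 2 hq) ?_
  linear_combination h1

end OcticSum

/-! ### Representations by `x² + 2y²` and two-to-one maps -/

theorem Finset.card_eq_two_mul_card_image {α β : Type*} [DecidableEq α] [DecidableEq β]
    (B : Finset α) (φ : α → β) (τ : α → α)
    (h : ∀ w ∈ B, τ w ∈ B ∧ τ w ≠ w ∧ φ (τ w) = φ w)
    (h2 : ∀ w ∈ B, ∀ w' ∈ B, φ w' = φ w → w' = w ∨ w' = τ w) :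
    B.card = 2 * (B.image φ).card := by
  rw [card_eq_sum_card_image φ B, sum_const_nat (m := 2), mul_comm]
  intro x hx
  obtain ⟨w, hw, rfl⟩ := mem_image.1 hx
  obtain ⟨h3, h4, h5⟩ := h w hw
  rw [card_eq_two]
  refine ⟨w, τ w, h4.symm, ?_⟩
  ext w'
  simp only [mem_filter, mem_insert, mem_singleton]
  constructor
  · rintro ⟨h6, h7⟩
    exact h2 w hw w' h6 h7
  · rintro (rfl | rfl)
    · exact ⟨hw, rfl⟩
    · exact ⟨h3, h5⟩

/-- A prime has at most one representation by the form `x² + 2y²`, up to signs. -/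
theorem sq_eq_sq_of_sq_add_two_mul_sq {p : ℕ} (hp : p.Prime) {x r c d : ℤ}
    (h1 : (p : ℤ) = x ^ 2 + 2 * r ^ 2) (h2 : (p : ℤ) = c ^ 2 + 2 * d ^ 2) : x ^ 2 = c ^ 2 := by
  have hpp : Prime (p : ℤ) := Nat.prime_iff_prime_int.1 hp
  have hp0 : (p : ℤ) ≠ 0 := hpp.ne_zero
  have key : ∀ r : ℤ, (p : ℤ) = x ^ 2 + 2 * r ^ 2 → (p : ℤ) ∣ x * d - c * r → x ^ 2 = c ^ 2 := by
    rintro r h1 ⟨e, he⟩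
    have h3 : (p : ℤ) ^ 2 = (x * c + 2 * r * d) ^ 2 + (p : ℤ) ^ 2 * (2 * e ^ 2) := by
      have : (p : ℤ) * p = (x ^ 2 + 2 * r ^ 2) * (c ^ 2 + 2 * d ^ 2) := by rw [← h1, ← h2]
      linear_combination this + 2 * (x * d - c * r + p * e) * he
    -- Otherwise the norm identity for `(x + r √-2)(c - d √-2)` would give `p² ≥ 2p²`.
    have he0 : e = 0 := by
      by_contra hne
      have h4 : 0 < e ^ 2 := by positivity
      have h5 : (0 : ℤ) < p ^ 2 := by positivity
      nlinarith [sq_nonneg (x * c + 2 * r * d)]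
    rw [he0, mul_zero] at he
    have h6 : (p : ℤ) * (x ^ 2 - c ^ 2) = 0 := by
      linear_combination 2 * (x * d + c * r) * he + x ^ 2 * h2 - c ^ 2 * h1
    have := (mul_eq_zero.1 h6).resolve_left hp0
    linarith
  have h3 : (p : ℤ) ∣ (x * d - c * r) * (x * d + c * r) := by
    refine ⟨d ^ 2 - r ^ 2, ?_⟩
    linear_combination r ^ 2 * h2 - d ^ 2 * h1
  rcases hpp.dvd_or_dvd h3 with h | h
  · exact key r h1 h
  · exact key (-r) (by rw [h1]; ring) (by rwa [mul_neg, sub_neg_eq_add])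

/-! ### The cubic character sum -/

section CubicCharSum
open scoped QuadraticAlgebra
variable {F : Type*} [Field F] [Fintype F] [DecidableEq F]

local notation "χ" => quadraticChar F

variable (F) in
/-- The sum of `χ((u + 1)(u² - 6u + 1))`; the trace of Frobenius, up to sign, of a curve with
complex multiplication by `ℤ[√-2]`. -/
def cubicCharSum : ℤ := ∑ u : F, χ ((u + 1) * (u ^ 2 - 6 * u + 1))

theorem sum_comp_sq (hF : ringChar F ≠ 2) (f : F → ℤ) :
    ∑ t : F, f (t ^ 2) = ∑ u : F, (χ u + 1) * f u := by
  rw [← sum_fiberwise univ (fun t : F => t ^ 2)]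
  refine sum_congr rfl fun u _ => ?_
  rw [← quadraticChar_card_sqrts hF, sum_congr rfl fun t ht => (?_ : _ = f u), sum_const,
    nsmul_eq_mul]
  · congr 3
    ext t
    simp
  · rw [(mem_filter.1 ht).2]

theorem octicLineSum_one : octicLineSum (1 : GaussianExt F) =
    1 + ∑ t : F, χ (t ^ 2 + 1) * χ (t ^ 4 - 6 * t ^ 2 + 1) := by
  unfold octicLineSum
  congr 1
  · simp
  · refine sum_congr rfl fun t _ => ?_
    congr 2
    simp [pow_succ]
    ring

/-- The genus two curve `y² = (t² + 1)(t⁴ - 6t² + 1)` covers `y² = f(u)` and `y² = u f(u)` through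
`u = t²`; these contribute equally because `f` is palindromic. -/
theorem octicLineSum_one_eq_cubicCharSum (hF : ringChar F ≠ 2) :
    octicLineSum (1 : GaussianExt F) = 2 * cubicCharSum F := by
  have e1 : ∀ t : F, χ (t ^ 2 + 1) * χ (t ^ 4 - 6 * t ^ 2 + 1) =
      χ ((t ^ 2 + 1) * ((t ^ 2) ^ 2 - 6 * t ^ 2 + 1)) := fun t => by
    rw [map_mul]; congr 2; ring
  have e2 : ∑ u : F, χ u * χ ((u + 1) * (u ^ 2 - 6 * u + 1)) = cubicCharSum F - 1 := by
    unfold cubicCharSum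
    rw [← Equiv.sum_comp (Equiv.inv F), Fintype.sum_eq_add_sum_compl 0,
      Fintype.sum_eq_add_sum_compl 0 (fun u : F => χ ((u + 1) * (u ^ 2 - 6 * u + 1)))]
    have : ∑ u ∈ {0}ᶜ, χ (Equiv.inv F u) * χ ((Equiv.inv F u + 1) *
        (Equiv.inv F u ^ 2 - 6 * Equiv.inv F u + 1)) =
        ∑ u ∈ ({0}ᶜ : Finset F), χ ((u + 1) * (u ^ 2 - 6 * u + 1)) := by
      refine sum_congr rfl fun u hu => ?_
      have hu : u ≠ 0 := by simpa [mem_compl] using hu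
      have e3 : u⁻¹ * ((u⁻¹ + 1) * (u⁻¹ ^ 2 - 6 * u⁻¹ + 1)) =
          (u + 1) * (u ^ 2 - 6 * u + 1) * ((u⁻¹) ^ 2) ^ 2 := by
        field_simp
        ring
      rw [Equiv.inv_apply, ← map_mul, e3, map_mul,
        quadraticChar_sq_one' (pow_ne_zero 2 (inv_ne_zero hu)), mul_one]
    rw [this]
    simp
  rw [octicLineSum_one, sum_congr rfl fun t _ => e1 t,
    sum_comp_sq hF fun u => χ ((u + 1) * (u ^ 2 - 6 * u + 1))]
  rw [sum_congr rfl fun u _ => add_one_mul (χ u) _, sum_add_distrib, e2]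
  unfold cubicCharSum
  ring

/-- The Möbius maps `t ↦ -t`, `t ↦ 1/t` and `t ↦ (1 + t)/(1 - t)` generate a group of order `8`
preserving the summand `χ(t² + 1) χ(t⁴ - 6t² + 1)`. It acts freely where the summand is `-1`. The
quotient is taken in three steps `t ↦ u = t²`, `u ↦ v = u + 1/u`, and the involution
`(v - 2)(v' - 2) = 16`. -/
theorem eight_dvd_card_filter (hF : ringChar F ≠ 2) (h : χ (-2) = 1) :
    8 ∣ (univ.filter fun t : F => χ (t ^ 2 + 1) * χ (t ^ 4 - 6 * t ^ 2 + 1) = -1).card := by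
  have h2 : (2 : F) ≠ 0 := Ring.two_ne_zero hF
  set B := univ.filter fun t : F => χ (t ^ 2 + 1) * χ (t ^ 4 - 6 * t ^ 2 + 1) = -1 with hB
  have hBm : ∀ t, t ∈ B ↔ χ (t ^ 2 + 1) * χ (t ^ 4 - 6 * t ^ 2 + 1) = -1 := fun t => by simp [hB]
  have hn1 : ∀ t ∈ B, t ^ 2 + 1 ≠ 0 := fun t ht e => by
    rw [hBm, e] at ht; simp at ht
  have hn2 : ∀ t ∈ B, t ^ 4 - 6 * t ^ 2 + 1 ≠ 0 := fun t ht e => by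
    rw [hBm, e] at ht; simp at ht
  have hn0 : ∀ t ∈ B, t ≠ 0 := fun t ht e => by
    rw [hBm, e] at ht; simp at ht
  have hn3 : ∀ t ∈ B, t ^ 2 - 1 ≠ 0 := fun t ht e => by
    rw [hBm, ← map_mul, show (t ^ 2 + 1) * (t ^ 4 - 6 * t ^ 2 + 1) =
      -2 * 2 ^ 2 + (t ^ 4 - 4 * t ^ 2 - 9) * (t ^ 2 - 1) by ring, e, mul_zero, add_zero, map_mul, h,
      quadraticChar_sq_one' h2] at ht
    norm_num at ht
  have hinv : ∀ t ∈ B, t⁻¹ ∈ B := fun t ht => by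
    have ht0 := hn0 t ht
    rw [hBm] at ht ⊢
    rw [← ht, show t⁻¹ ^ 2 + 1 = (t ^ 2 + 1) * (t⁻¹) ^ 2 by field_simp; ring,
      show t⁻¹ ^ 4 - 6 * t⁻¹ ^ 2 + 1 = (t ^ 4 - 6 * t ^ 2 + 1) * ((t⁻¹) ^ 2) ^ 2 by
        field_simp; ring, map_mul, map_mul, quadraticChar_sq_one' (inv_ne_zero ht0),
      quadraticChar_sq_one' (pow_ne_zero 2 (inv_ne_zero ht0)), mul_one, mul_one]
  have hrot : ∀ t ∈ B, (1 + t) * (1 - t)⁻¹ ∈ B := fun t ht => by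
    have h1 : 1 - t ≠ 0 := fun e => hn3 t ht (by linear_combination (-(1 + t)) * e)
    rw [hBm] at ht ⊢
    rw [← ht, ← map_mul, ← map_mul,
      show (((1 + t) * (1 - t)⁻¹) ^ 2 + 1) * (((1 + t) * (1 - t)⁻¹) ^ 4 -
        6 * ((1 + t) * (1 - t)⁻¹) ^ 2 + 1) = -2 * ((t ^ 2 + 1) * (t ^ 4 - 6 * t ^ 2 + 1)) *
          (2 * ((1 - t)⁻¹) ^ 3) ^ 2 by field_simp; ring, map_mul, map_mul _ (-2), h,
      quadraticChar_sq_one' (mul_ne_zero h2 (pow_ne_zero 3 (inv_ne_zero h1))), mul_one, one_mul]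
  have s1 := B.card_eq_two_mul_card_image (fun t => t ^ 2) (fun t => -t)
    (fun t ht => ⟨by rw [hBm] at ht ⊢; rwa [neg_sq, show (-t) ^ 4 = t ^ 4 by ring],
      fun e => hn0 t ht (by
        have : 2 * t = 0 := by linear_combination -e
        simpa [h2] using this), neg_sq t⟩)
    (fun t _ t' _ e => sq_eq_sq_iff_eq_or_eq_neg.1 e)
  set B1 := B.image fun t => t ^ 2 with hB1
  have s2 := B1.card_eq_two_mul_card_image (fun u => u + u⁻¹) (fun u => u⁻¹)
    (by
      intro u hu
      obtain ⟨t, ht, rfl⟩ := mem_image.1 hu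
      refine ⟨mem_image.2 ⟨t⁻¹, hinv t ht, inv_pow t 2⟩, fun e => ?_, by
        simp only [inv_inv]; ring⟩
      have ht0 := hn0 t ht
      have e' : (t ^ 2 - 1) * (t ^ 2 + 1) = 0 := by
        field_simp at e
        linear_combination -e
      rcases mul_eq_zero.1 e' with h | h
      · exact hn3 t ht h
      · exact hn1 t ht h)
    (by
      intro u hu u' hu' e
      obtain ⟨t, ht, rfl⟩ := mem_image.1 hu
      obtain ⟨t', ht', rfl⟩ := mem_image.1 hu'
      have h1 := pow_ne_zero 2 (hn0 t ht)
      have h2 := pow_ne_zero 2 (hn0 t' ht')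
      generalize t ^ 2 = u at *
      generalize t' ^ 2 = u' at *
      have e' : (u' - u) * (u' * u - 1) = 0 := by
        field_simp at e
        linear_combination e
      rcases mul_eq_zero.1 e' with h | h
      · exact Or.inl (by linear_combination h)
      · exact Or.inr (eq_inv_of_mul_eq_one_left (by linear_combination h)))
  set B2 := B1.image fun u => u + u⁻¹ with hB2
  have hv : ∀ v ∈ B2, ∃ t ∈ B, v = t ^ 2 + (t ^ 2)⁻¹ := fun v hv => by
    obtain ⟨u, hu, rfl⟩ := mem_image.1 hv
    obtain ⟨t, ht, rfl⟩ := mem_image.1 hu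
    exact ⟨t, ht, rfl⟩
  have hv2 : ∀ v ∈ B2, v - 2 ≠ 0 := fun v hvB e => by
    obtain ⟨t, ht, rfl⟩ := hv v hvB
    have ht0 := hn0 t ht
    have : (t ^ 2 - 1) ^ 2 = 0 := by
      field_simp at e
      linear_combination e
    exact hn3 t ht (by simpa using this)
  have s3 := B2.card_eq_two_mul_card_image (fun v => (v - 2) + 16 * (v - 2)⁻¹)
    (fun v => 2 + 16 * (v - 2)⁻¹)
    (by
      intro v hvB
      have hv0 := hv2 v hvB
      have h16 : (16 : F) ≠ 0 := by
        rw [show (16 : F) = 2 ^ 4 by norm_num]; exact pow_ne_zero _ h2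
      refine ⟨?_, fun e => ?_, ?_⟩
      · obtain ⟨t, ht, rfl⟩ := hv v hvB
        refine mem_image.2 ⟨_, mem_image.2 ⟨_, hrot t ht, rfl⟩, ?_⟩
        have ht0 := hn0 t ht
        have h1 : 1 - t ≠ 0 := fun e => hn3 t ht (by linear_combination (-(1 + t)) * e)
        have h1' : 1 + t ≠ 0 := fun e => hn3 t ht (by linear_combination (t - 1) * e)
        have e2 : t ^ 2 + (t ^ 2)⁻¹ - 2 = ((1 - t) * (1 + t) * t⁻¹) ^ 2 := by
          field_simp
          ring
        rw [e2]
        field_simp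
        ring
      · have e' : (v - 2 - 4) * (v + 2) = 0 := by
          field_simp at e
          linear_combination -e
        obtain ⟨t, ht, rfl⟩ := hv v hvB
        have ht0 := hn0 t ht
        rcases mul_eq_zero.1 e' with h | h
        · refine hn2 t ht ?_
          field_simp at h
          linear_combination h
        · have : (t ^ 2 + 1) ^ 2 = 0 := by
            field_simp at h
            linear_combination h
          exact hn1 t ht (by simpa using this)
      · rw [add_sub_cancel_left, mul_inv, inv_inv, mul_inv_cancel_left₀ h16, add_comm])
    (by
      intro v hvB v' hvB' e
      have h1 := hv2 v hvB
      have h2 := hv2 v' hvB'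
      have e' : (v' - v) * ((v' - 2) * (v - 2) - 16) = 0 := by
        field_simp at e
        linear_combination e
      rcases mul_eq_zero.1 e' with h | h
      · exact Or.inl (by linear_combination h)
      · refine Or.inr ?_
        field_simp
        linear_combination h)
  rw [s1, s2, s3]
  exact ⟨_, by ring⟩

/-- The zeros of the summand: `±i` and `±1 ± √2` if `i`, and hence `√2`, lies in `F`, and none
otherwise. -/
theorem card_filter_eq_zero (hF : ringChar F ≠ 2) (h : χ (-2) = 1) :
    (univ.filter fun t : F => χ (t ^ 2 + 1) * χ (t ^ 4 - 6 * t ^ 2 + 1) = 0).card =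
      if χ (-1) = 1 then 6 else 0 := by
  have h2 : (2 : F) ≠ 0 := Ring.two_ne_zero hF
  have hm : ∀ t : F, χ (t ^ 2 + 1) * χ (t ^ 4 - 6 * t ^ 2 + 1) = 0 ↔
      t ^ 2 + 1 = 0 ∨ t ^ 4 - 6 * t ^ 2 + 1 = 0 := fun t => by
    rw [mul_eq_zero, quadraticChar_eq_zero_iff, quadraticChar_eq_zero_iff]
  have hprod : χ (-1) * χ 2 = 1 := by rw [← map_mul, ← h]; norm_num
  split_ifs with h1
  · rw [h1, one_mul] at hprod
    obtain ⟨i, hi⟩ := (quadraticChar_one_iff_isSquare (neg_ne_zero.2 one_ne_zero)).1 h1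
    obtain ⟨r, hr⟩ := (quadraticChar_one_iff_isSquare h2).1 hprod
    have hi0 : i ≠ 0 := fun e => by simp [e] at hi
    have hr0 : r ≠ 0 := fun e => h2 (by rw [hr, e, mul_zero])
    have key : ∀ t : F, t ^ 2 + 1 = 0 → t ^ 4 - 6 * t ^ 2 + 1 = 0 → False := fun t e1 e2 => by
      have : (2 : F) ^ 3 = 0 := by linear_combination e2 - (t ^ 2 - 7) * e1
      exact pow_ne_zero 3 h2 this
    have hset : (univ.filter fun t : F => χ (t ^ 2 + 1) * χ (t ^ 4 - 6 * t ^ 2 + 1) = 0) =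
        {i, -i} ∪ {1 + r, 1 - r, -1 + r, -1 - r} := by
      ext t
      simp only [mem_filter, mem_univ, true_and, hm, mem_union, mem_insert, mem_singleton]
      have e1 : t ^ 2 + 1 = (t - i) * (t - -i) := by linear_combination -hi
      have e2 : t ^ 4 - 6 * t ^ 2 + 1 =
          (t - (1 + r)) * ((t - (1 - r)) * ((t - (-1 + r)) * (t - (-1 - r)))) := by
        linear_combination (-2 * t ^ 2 + r ^ 2) * hr
      simp only [e1, e2, mul_eq_zero, sub_eq_zero]
    have n1 : i ≠ -i := fun e => mul_ne_zero h2 hi0 (by linear_combination e)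
    have n2 : 1 + r ≠ 1 - r := fun e => mul_ne_zero h2 hr0 (by linear_combination e)
    have n3 : 1 + r ≠ -1 + r := fun e => h2 (by linear_combination e)
    have hr1 : r ^ 2 - 1 ≠ 0 := fun e => one_ne_zero (by linear_combination e + hr)
    have n4 : 1 + r ≠ -1 - r := fun e => mul_ne_zero h2 hr1 (by linear_combination (r - 1) * e)
    have n5 : 1 - r ≠ -1 + r := fun e => mul_ne_zero h2 hr1 (by linear_combination (-1 - r) * e)
    have n6 : 1 - r ≠ -1 - r := fun e => h2 (by linear_combination e)
    have n7 : -1 + r ≠ -1 - r := fun e => mul_ne_zero h2 hr0 (by linear_combination e)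
    rw [hset, card_union_of_disjoint, card_pair n1, card_insert_of_notMem,
      card_insert_of_notMem, card_pair n7]
    · simp [n5, n6]
    · simp [n2, n3, n4]
    · rw [disjoint_left]
      intro t ht ht'
      refine key t ?_ ?_
      · simp only [mem_insert, mem_singleton] at ht
        rcases ht with rfl | rfl <;> linear_combination -hi
      · simp only [mem_insert, mem_singleton] at ht'
        rcases ht' with rfl | rfl | rfl | rfl
        · linear_combination (-(r ^ 2 + 4 * r + 2)) * hr
        · linear_combination (-(r ^ 2 - 4 * r + 2)) * hr
        · linear_combination (-(r ^ 2 - 4 * r + 2)) * hr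
        · linear_combination (-(r ^ 2 + 4 * r + 2)) * hr
  · have hm1 : χ (-1) = -1 :=
      (quadraticChar_dichotomy (neg_ne_zero.2 one_ne_zero)).resolve_left h1
    rw [card_eq_zero, filter_eq_empty_iff]
    intro t _
    rw [hm]
    rintro (e | e)
    · exact quadraticChar_neg_one_iff_not_isSquare.1 hm1 ⟨t, by linear_combination -e⟩
    · have h3 : χ 2 = -1 := by rw [hm1] at hprod; omega
      refine quadraticChar_neg_one_iff_not_isSquare.1 h3 ⟨(t ^ 2 - 3) * 2⁻¹, ?_⟩
      field_simp
      linear_combination -e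

/-- The summand takes the values `0`, `1` and `-1`, the first on the set counted by
`card_filter_eq_zero` and the last on a set of cardinality divisible by `8`. -/
theorem octicLineSum_one_modEq (hF : ringChar F ≠ 2) (h : χ (-2) = 1) :
    ∃ k : ℤ, octicLineSum (1 : GaussianExt F) =
      Fintype.card F + 1 - (if χ (-1) = 1 then 6 else 0) - 16 * k := by
  obtain ⟨k, hk⟩ := eight_dvd_card_filter hF h
  have hz := card_filter_eq_zero hF h
  refine ⟨k, ?_⟩
  rw [octicLineSum_one]
  have e : ∀ t : F, χ (t ^ 2 + 1) * χ (t ^ 4 - 6 * t ^ 2 + 1) =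
      1 - (if χ (t ^ 2 + 1) * χ (t ^ 4 - 6 * t ^ 2 + 1) = 0 then 1 else 0) -
        2 * (if χ (t ^ 2 + 1) * χ (t ^ 4 - 6 * t ^ 2 + 1) = -1 then 1 else 0) := fun t => by
    rw [← map_mul]
    by_cases h0 : (t ^ 2 + 1) * (t ^ 4 - 6 * t ^ 2 + 1) = 0
    · simp [h0]
    · rcases quadraticChar_dichotomy h0 with h | h <;> simp [h]
  rw [sum_congr rfl fun t _ => e t, sum_sub_distrib, sum_sub_distrib, ← mul_sum, sum_boole,
    sum_boole, hz, hk]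
  simp only [sum_const, card_univ, nsmul_eq_mul]
  push_cast
  ring

end CubicCharSum

theorem ringChar_zmod_ne_two {p : ℕ} (hp : p ≠ 2) : ringChar (ZMod p) ≠ 2 := by
  rwa [ZMod.ringChar_zmod_n]

theorem quadraticChar_neg_two_eq_one {p : ℕ} [Fact p.Prime] (hp : p % 8 = 1 ∨ p % 8 = 3) :
    quadraticChar (ZMod p) (-2) = 1 := by
  rw [quadraticChar_neg_two (ringChar_zmod_ne_two (by omega)), ZMod.card,
    ZMod.χ₈'_nat_eq_if_mod_eight, if_neg (by omega), if_pos (by omega)]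

theorem cubicCharSum_eq_zero {p : ℕ} [Fact p.Prime] (hp : p % 8 = 5 ∨ p % 8 = 7) :
    cubicCharSum (ZMod p) = 0 := by
  have hF : ringChar (ZMod p) ≠ 2 := ringChar_zmod_ne_two (by omega)
  have h : quadraticChar (ZMod p) (-2) = -1 := by
    rw [quadraticChar_neg_two hF, ZMod.card, ZMod.χ₈'_nat_eq_if_mod_eight, if_neg (by omega),
      if_neg (by omega)]
  have h1 := octicSum_one_of_neg_two hF h
  rw [octicSum_eq_octicLineSum, octicLineSum_one_eq_cubicCharSum hF, ZMod.card] at h1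
  have := (Fact.out : p.Prime).one_lt
  rcases mul_eq_zero.1 h1 with h2 | h2 <;> omega

/-- The sum is `4x / 2` with `x = ±c`; the sign is read off from `4x` modulo `16`. -/
theorem cubicCharSum_eq {p : ℕ} [Fact p.Prime] (hp : p % 8 = 1 ∨ p % 8 = 3) {c d : ℤ}
    (hcd : (p : ℤ) = c ^ 2 + 2 * d ^ 2) (hc : c ≡ 1 [ZMOD 4]) :
    cubicCharSum (ZMod p) = -((-1) ^ (p / 8) * quadraticChar (ZMod p) (-1) * (2 * c)) := by
  have hF : ringChar (ZMod p) ≠ 2 := ringChar_zmod_ne_two (by omega)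
  have h := quadraticChar_neg_two_eq_one hp
  obtain ⟨y, hy⟩ := octicLineSum_one_sq_add hF h
  obtain ⟨k, hk⟩ := octicLineSum_one_modEq hF h
  rw [octicLineSum_one_eq_cubicCharSum hF, ZMod.card] at hy hk
  set S := cubicCharSum (ZMod p)
  obtain ⟨y1, rfl⟩ : Even y := by
    have : Even (y ^ 2) := ⟨4 * p - S ^ 2, by linarith⟩
    exact (Int.even_pow' two_ne_zero).1 this
  obtain ⟨x, hx⟩ : Even S := by
    have : Even (S ^ 2) := ⟨2 * p - y1 ^ 2, by linarith⟩
    exact (Int.even_pow' two_ne_zero).1 this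
  rw [hx] at hy hk ⊢
  obtain ⟨r, rfl⟩ : Even y1 := by
    have : Even (y1 ^ 2) := ⟨p - x ^ 2, by linarith⟩
    exact (Int.even_pow' two_ne_zero).1 this
  have hxc := sq_eq_sq_of_sq_add_two_mul_sq (Fact.out : p.Prime) (x := x) (r := r)
    (by linarith) hcd
  have h1 : quadraticChar (ZMod p) (-1) = if p % 8 = 1 then 1 else -1 := by
    rw [quadraticChar_neg_one hF, ZMod.card, ZMod.χ₄_nat_eq_if_mod_four]
    rw [if_neg (by omega)]
    split_ifs <;> omega
  rw [h1] at hk ⊢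
  unfold Int.ModEq at hc
  have hpar : (-1 : ℤ) ^ (p / 8) = if p / 8 % 2 = 0 then 1 else -1 := by
    split_ifs with h
    · exact Even.neg_one_pow (Nat.even_iff.2 h)
    · exact Odd.neg_one_pow (Nat.odd_iff.2 (by omega))
  rw [hpar]
  rcases sq_eq_sq_iff_eq_or_eq_neg.1 hxc with rfl | rfl <;> rcases hp with hp | hp <;>
    simp only [hp] at hk ⊢ <;> norm_num at hk ⊢ <;> split_ifs <;> omega

/-! ### Binomial coefficients modulo `p` -/

/-- Congruences modulo `p` hold in every ring in which `p = 0`; such rings are not assumed to be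
nontrivial. -/
theorem intCast_eq_of_zmod {p : ℕ} {R : Type*} [CommRing R] (hR : (p : R) = 0) {a b : ℤ}
    (h : (a : ZMod p) = b) : (a : R) = b := by
  obtain ⟨k, hk⟩ := (ZMod.intCast_eq_intCast_iff_dvd_sub a b p).1 h
  have := congrArg (Int.cast : ℤ → R) hk
  push_cast at this
  rw [hR, zero_mul, sub_eq_zero] at this
  exact this.symm

section Binomials
variable {p : ℕ} [Fact p.Prime]

theorem natCast_succ_ne_zero {l : ℕ} (h : l + 1 < p) : ((l : ZMod p) + 1) ≠ 0 := by
  rw [← Nat.cast_succ, Ne, ZMod.natCast_eq_zero_iff]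
  exact Nat.not_dvd_of_pos_of_lt (Nat.succ_pos l) h

theorem choose_half_mul {n : ℕ} (hn : p = 2 * n + 1) {l : ℕ} (hl : l ≤ n) :
    (n.choose l : ZMod p) * (-4) ^ l = ((2 * l).choose l : ℕ) := by
  induction l with
  | zero => simp
  | succ l ih =>
    have h0 : ((l : ZMod p) + 1) ≠ 0 := natCast_succ_ne_zero (by omega)
    have h1 := congrArg (Nat.cast : ℕ → ZMod p) (Nat.choose_succ_right_eq n l)
    have h2 := congrArg (Nat.cast : ℕ → ZMod p) (Nat.succ_mul_centralBinom_succ l)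
    rw [Nat.centralBinom, Nat.centralBinom] at h2
    have hp : (2 * n + 1 : ZMod p) = 0 := by
      have : ((2 * n + 1 : ℕ) : ZMod p) = 0 := by rw [← hn]; simp
      exact_mod_cast this
    push_cast [Nat.cast_sub (show l ≤ n by omega)] at h1 h2
    refine mul_left_cancel₀ h0 ?_
    have h3 := ih (by omega)
    rw [h2, ← h3, pow_succ]
    linear_combination (-4) ^ l * (-4) * h1 - 2 * (n.choose l) * (-4) ^ l * hp

theorem choose_prime_sub {m l : ℕ} (h : m + l < p) :
    ((p - 1 - m).choose l : ZMod p) = (-1) ^ l * ((m + l).choose l : ℕ) := by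
  induction l with
  | zero => simp
  | succ l ih =>
    have h0 : ((l : ZMod p) + 1) ≠ 0 := natCast_succ_ne_zero (by omega)
    have h1 := congrArg (Nat.cast : ℕ → ZMod p) (Nat.choose_succ_right_eq (p - 1 - m) l)
    have h2 := congrArg (Nat.cast : ℕ → ZMod p) (Nat.add_one_mul_choose_eq (m + l) l)
    have h4 : ((p - 1 - m - l : ℕ) : ZMod p) = -(m + l + 1) := by
      have : ((p - 1 - m - l + (m + l + 1) : ℕ) : ZMod p) = 0 := by
        rw [show p - 1 - m - l + (m + l + 1) = p by omega]; simp
      push_cast at this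
      linear_combination this
    rw [Nat.cast_mul, Nat.cast_mul, h4, ih (by omega)] at h1
    push_cast at h1 h2
    rw [show m + (l + 1) = m + l + 1 by ring]
    refine mul_left_cancel₀ h0 ?_
    rw [pow_succ]
    linear_combination h1 - (-1) ^ l * h2

theorem choose_mul_pow_mul_choose {n : ℕ} (hn : p = 2 * n + 1) {l : ℕ} (hl : 3 * l ≤ 2 * n) :
    ((n.choose l * 4 ^ l * (2 * (n - l)).choose l : ℕ) : ZMod p) =
      ((2 * l).choose l * (3 * l).choose l : ℕ) := by
  have h1 := choose_half_mul hn (l := l) (by omega)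
  have h2 := choose_prime_sub (p := p) (m := 2 * l) (l := l) (by omega)
  rw [show p - 1 - 2 * l = 2 * (n - l) by omega, show 2 * l + l = 3 * l by ring] at h2
  push_cast
  rw [h2, ← h1, neg_pow (4 : ZMod p)]
  ring

/-- With `n = [p/3]` one has `9n(n + 1) ≡ -2`, so the ratios of consecutive coefficients of the
shifted Legendre polynomial agree modulo `p` with those of `C(2k,k) C(3k,k) / (-27)^k`. -/
theorem choose_third_mul (hp3 : p ≠ 3) {k : ℕ} (hk : k ≤ p / 3) :
    (((p / 3).choose k * (p / 3 + k).choose (p / 3) : ℕ) : ZMod p) * (-27) ^ k =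
      ((2 * k).choose k * (3 * k).choose k : ℕ) := by
  have hpp : p.Prime := Fact.out
  induction k with
  | zero => simp
  | succ k ih =>
    set n := p / 3 with hn
    have h0 : ((k : ZMod p) + 1) ≠ 0 := natCast_succ_ne_zero (by omega)
    have h1 := congrArg (Nat.cast : ℕ → ZMod p) (Nat.choose_succ_right_eq n k)
    have h2 := congrArg (Nat.cast : ℕ → ZMod p) (Nat.add_one_mul_choose_eq (n + k) k)
    rw [Nat.choose_symm_add.symm,
      ← Nat.choose_symm_of_eq_add (show n + k + 1 = n + (k + 1) by ring)] at h2
    have h3 := congrArg (Nat.cast : ℕ → ZMod p) (choose_mul_choose_succ k)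
    have h4 := ih (by omega)
    have hnn : (9 * n * (n + 1) + 2 : ZMod p) = 0 := by
      have hdvd : p ∣ 9 * n * (n + 1) + 2 := by
        have : p % 3 ≠ 0 := fun e => hp3 ((Nat.prime_dvd_prime_iff_eq Nat.prime_three hpp).1
          (Nat.dvd_of_mod_eq_zero e)).symm
        rcases (by omega : p = 3 * n + 1 ∨ p = 3 * n + 2) with e | e
        · exact ⟨3 * n + 2, by rw [e]; ring⟩
        · exact ⟨3 * n + 1, by rw [e]; ring⟩
      have := (ZMod.natCast_eq_zero_iff (9 * n * (n + 1) + 2) p).2 hdvd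
      exact_mod_cast this
    push_cast [Nat.cast_sub (show k ≤ n by omega)] at h1 h2 h3 h4 ⊢
    refine mul_left_cancel₀ (pow_ne_zero 2 h0) ?_
    rw [show n + (k + 1) = n + k + 1 by ring]
    rw [mul_comm _ (((2 * (k + 1)).choose (k + 1) : ZMod p) * _), h3, ← h4, pow_succ]
    linear_combination (-27) ^ (k + 1) * ((k : ZMod p) + 1) * ((n + k + 1).choose n) * h1 -
      (-27) ^ (k + 1) * (n.choose k) * (n - k) * h2 -
      3 * (-27) ^ k * (n.choose k) * ((n + k).choose n) * hnn

end Binomials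

/-! ### The Hasse invariant -/

section Hasse
variable {p : ℕ} [Fact p.Prime] {R : Type*} [CommRing R]

/-- The Hasse invariant of `y² = 4x³ + (x + u)²` as a truncated hypergeometric sum. -/
theorem coeff_hasse (hp3 : p ≠ 3) {n : ℕ} (hn : p = 2 * n + 1) (hR : (p : R) = 0) (u : R) :
    ((4 * X ^ 3 + (X + C u) ^ 2 : R[X]) ^ n).coeff (p - 1) =
      ∑ k ∈ range (p / 3 + 1), ((2 * k).choose k * (3 * k).choose k : ℕ) * u ^ k := by
  have hpp : p.Prime := Fact.out
  have h3 : p % 3 ≠ 0 := fun e => hp3 ((Nat.prime_dvd_prime_iff_eq Nat.prime_three hpp).1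
          (Nat.dvd_of_mod_eq_zero e)).symm
  have e : ∀ l, (((4 * X ^ 3 : R[X]) ^ l * ((X + C u) ^ 2) ^ (n - l) *
      (n.choose l : R[X])).coeff (p - 1)) = if 3 * l ≤ 2 * n then
        (n.choose l * 4 ^ l : R) * ((X + C u) ^ (2 * (n - l))).coeff (2 * n - 3 * l) else 0 := by
    intro l
    have : (4 * X ^ 3 : R[X]) ^ l * ((X + C u) ^ 2) ^ (n - l) * (n.choose l : R[X]) =
        C (n.choose l * 4 ^ l : R) * (X ^ (3 * l) * (X + C u) ^ (2 * (n - l))) := by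
      simp only [map_mul, map_pow, map_natCast, map_ofNat, ← pow_mul (X + C u)]
      ring
    rw [this, coeff_C_mul, coeff_X_pow_mul', show p - 1 = 2 * n by omega]
    split_ifs <;> simp
  rw [add_pow, finsetSum_coeff, sum_congr rfl fun l _ => e l]
  symm
  refine sum_subset_zero_on_sdiff (range_subset_range.2 (by omega)) ?_ ?_
  · intro l hl
    simp only [mem_sdiff, mem_range] at hl
    rw [if_neg (by omega)]
  · intro l hl
    rw [mem_range] at hl
    rw [if_pos (by omega), coeff_X_add_C_pow, show 2 * (n - l) - (2 * n - 3 * l) = l by omega,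
      Nat.choose_symm_of_eq_add (show 2 * (n - l) = (2 * n - 3 * l) + l by omega)]
    have h := intCast_eq_of_zmod hR (a := ((2 * l).choose l * (3 * l).choose l : ℕ))
      (b := (n.choose l * 4 ^ l * (2 * (n - l)).choose l : ℕ))
      (by
        rw [Int.cast_natCast, Int.cast_natCast]
        exact (choose_mul_pow_mul_choose hn (by omega)).symm)
    rw [Int.cast_natCast, Int.cast_natCast] at h
    rw [h]
    push_cast
    ring

/-- In degrees `p, …, 2p - 2` a translation contributes to the coefficient of `x^{p-1}` only with
binomial coefficients divisible by `p`. -/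
theorem coeff_comp_linear (hR : (p : R) = 0) {g : R[X]} (hg : g.natDegree < 2 * p - 1) (a b : R) :
    (g.comp (C a * X + C b)).coeff (p - 1) = a ^ (p - 1) * g.coeff (p - 1) := by
  have hpp : p.Prime := Fact.out
  have e : g.comp (C a * X + C b) = (taylor b g).comp (C a * X) := by
    rw [taylor_apply, comp_assoc]; simp
  have h : hasseDeriv (p - 1) g = C (g.coeff (p - 1)) := by
    ext j
    rw [hasseDeriv_coeff, coeff_C]
    split_ifs with hj
    · simp [hj]
    · rcases lt_or_ge (j + (p - 1)) (2 * p - 1) with h | h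
      · obtain ⟨m, hm⟩ := hpp.dvd_choose (show p - 1 < p by have := hpp.pos; omega)
          (show j + (p - 1) - (p - 1) < p by omega) (show p ≤ j + (p - 1) by omega)
        rw [hm, Nat.cast_mul, hR, zero_mul, zero_mul]
      · rw [coeff_eq_zero_of_natDegree_lt (by omega), mul_zero]
  rw [e, comp_C_mul_X_coeff, taylor_coeff, h, eval_C, mul_comm]

theorem sum_eval_eq_neg_coeff {g : (ZMod p)[X]} (hg : g.natDegree < 2 * (p - 1)) :
    ∑ x : ZMod p, g.eval x = -g.coeff (p - 1) := by
  have hpp : p.Prime := Fact.out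
  have h1 := hpp.one_lt
  simp only [eval_eq_sum_range' hg]
  rw [sum_comm, sum_eq_single (p - 1)]
  · rw [← mul_sum]
    have : ∑ x : ZMod p, x ^ (p - 1) = -1 := by
      rw [Fintype.sum_eq_add_sum_compl 0, sum_congr rfl fun x hx =>
        ZMod.pow_card_sub_one_eq_one (p := p) (by simpa [mem_compl] using hx)]
      rw [sum_const, card_compl, card_singleton, ZMod.card, nsmul_eq_mul,
        Nat.cast_sub h1.le, zero_pow (by omega)]
      simp
    rw [this]; ring
  · intro i _ hi
    rw [← mul_sum]
    rcases lt_or_ge i (p - 1) with h | h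
    · rw [FiniteField.sum_pow_lt_card_sub_one _ _ (by rwa [ZMod.card]), mul_zero]
    · have : ∑ x : ZMod p, x ^ i = ∑ x : ZMod p, x ^ (i - (p - 1)) := by
        refine sum_congr rfl fun x _ => ?_
        by_cases hx : x = 0
        · rw [hx, zero_pow (by omega), zero_pow (by omega)]
        · conv_lhs => rw [show i = (p - 1) + (i - (p - 1)) by omega, pow_add,
            ZMod.pow_card_sub_one_eq_one hx, one_mul]
      rw [mem_range] at *
      rw [this, FiniteField.sum_pow_lt_card_sub_one _ _ (by rw [ZMod.card]; omega), mul_zero]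
  · intro h
    rw [mem_range] at h
    omega

/-- The coefficient comes from `ℤ`, which transports its value from `ZMod p` to rings without a
map to or from `ZMod p` at hand. -/
theorem coeff_cubic_pow_eq_intCast (S : Type*) [CommRing S] (n m : ℕ) :
    (((X + 1) * (X ^ 2 - 6 * X + 1) : S[X]) ^ n).coeff m =
      ((((X + 1) * (X ^ 2 - 6 * X + 1) : ℤ[X]) ^ n).coeff m : ℤ) := by
  rw [← eq_intCast (Int.castRingHom S), ← coeff_map]
  simp

theorem coeff_cubic_pow {n : ℕ} (hn : p = 2 * n + 1) (hR : (p : R) = 0) :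
    (((X + 1) * (X ^ 2 - 6 * X + 1) : R[X]) ^ n).coeff (p - 1) = -(cubicCharSum (ZMod p) : R) := by
  have hpp : p.Prime := Fact.out
  rw [coeff_cubic_pow_eq_intCast, ← Int.cast_neg]
  refine intCast_eq_of_zmod hR ?_
  rw [← coeff_cubic_pow_eq_intCast]
  have hdeg : (((X + 1) * (X ^ 2 - 6 * X + 1) : (ZMod p)[X]) ^ n).natDegree < 2 * (p - 1) := by
    refine lt_of_le_of_lt natDegree_pow_le ?_
    have : ((X + 1) * (X ^ 2 - 6 * X + 1) : (ZMod p)[X]).natDegree ≤ 3 := by compute_degree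
    have := hpp.one_lt
    nlinarith [show p - 1 = 2 * n by omega]
  have h := sum_eval_eq_neg_coeff hdeg
  have hF : ringChar (ZMod p) ≠ 2 := ringChar_zmod_ne_two (by omega)
  rw [Int.cast_neg, ← neg_eq_iff_eq_neg, ← h, cubicCharSum, Int.cast_sum]
  refine sum_congr rfl fun x _ => ?_
  rw [quadraticChar_eq_pow_of_char_ne_two' hF, ZMod.card, show p / 2 = n by omega]
  simp

/-- For `u = (2 + 5√-2) / 108` the curve `y² = 4x³ + (x + u)²` is a twist of
`y² = (x + 1)(x² - 6x + 1)`: with `w = -(4 + 2√-2)` and `b = (1 - 2√-2) / 3`,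
`16 w³ (4x³ + (x + u)²) = f(4wx + b)`. The element `v` is the inverse of `108`. -/
theorem hasse_eq (hp3 : p ≠ 3) {n : ℕ} (hn : p = 2 * n + 1) (hR : (p : R) = 0) {s v w u : R}
    (hs : s ^ 2 = -2) (hv : 108 * v = 1) (hw : w = -(4 + 2 * s)) (hu : u = (2 + 5 * s) * v) :
    (16 * w ^ 3) ^ n *
        ∑ k ∈ range (p / 3 + 1), ((2 * k).choose k * (3 * k).choose k : ℕ) * u ^ k =
      (4 * w) ^ (p - 1) * -(cubicCharSum (ZMod p) : R) := by
  have hpp : p.Prime := Fact.out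
  have h0 : C (16 * w ^ 3) * (4 * X ^ 3 + (X + C u) ^ 2 : R[X]) =
      ((X + 1) * (X ^ 2 - 6 * X + 1) : R[X]).comp (C (4 * w) * X + C ((1 - 2 * s) * (36 * v))) := by
    have hs' : (C s) ^ 2 = (-2 : R[X]) := by
      rw [← C_pow, hs, C_neg, map_ofNat C 2]
    have hv' : 108 * C v = (1 : R[X]) := by rw [← map_ofNat C, ← C_mul, hv, C_1]
    simp only [mul_comp, add_comp, sub_comp, pow_comp, X_comp, one_comp, ofNat_comp, hu, hw,
      map_mul, map_neg, map_add, map_pow, map_sub, map_ofNat, map_one]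
    generalize C s = s' at *
    generalize C v = v' at *
    grind
  have hdeg : (((X + 1) * (X ^ 2 - 6 * X + 1) : R[X]) ^ n).natDegree < 2 * p - 1 := by
    refine lt_of_le_of_lt natDegree_pow_le ?_
    have : ((X + 1) * (X ^ 2 - 6 * X + 1) : R[X]).natDegree ≤ 3 := by compute_degree
    have : n * ((X + 1) * (X ^ 2 - 6 * X + 1) : R[X]).natDegree ≤ n * 3 := by gcongr
    omega
  rw [← coeff_hasse hp3 hn hR, ← coeff_cubic_pow hn hR,
    ← coeff_comp_linear hR hdeg _ ((1 - 2 * s) * (36 * v)), pow_comp, ← h0, mul_pow (C (16 * w ^ 3)), ← C_pow,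
    coeff_C_mul]

end Hasse

/-! ### Legendre polynomials -/

/-- Rodrigues' formula. -/
theorem iterate_derivative_sq_sub_one_pow (n : ℕ) :
    derivative^[n] ((X ^ 2 - 1 : ℚ[X]) ^ n) = C ((n.factorial : ℚ) * 2 ^ n) * legendrePoly n := by
  have h1 : ((X ^ 2 - 1 : ℚ[X]) ^ n) =
      ∑ k ∈ range (n + 1), C ((n.choose k : ℚ) * (-1) ^ k) * X ^ (2 * n - 2 * k) := by
    rw [sub_eq_neg_add, add_pow]
    refine sum_congr rfl fun k _ => ?_
    rw [← pow_mul, show 2 * (n - k) = 2 * n - 2 * k by omega]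
    simp only [map_mul, map_pow, map_natCast, map_neg, map_one]
    ring
  rw [h1, iterate_derivative_sum, legendrePoly, ← mul_assoc, ← C_mul, mul_sum]
  symm
  refine sum_subset_zero_on_sdiff (range_subset_range.2 (by omega)) ?_ ?_
  · intro k hk
    simp only [mem_sdiff, mem_range] at hk
    rw [iterate_derivative_C_mul, iterate_derivative_X_pow_eq_smul,
      Nat.descFactorial_eq_zero_iff_lt.2 (by omega)]
    simp
  · intro k hk
    rw [mem_range] at hk
    rw [iterate_derivative_C_mul, iterate_derivative_X_pow_eq_smul,
      Nat.descFactorial_eq_factorial_mul_choose, show 2 * n - 2 * k - n = n - 2 * k by omega,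
      smul_eq_C_mul, ← mul_assoc, ← mul_assoc, ← C_mul, ← C_mul]
    congr 2
    push_cast
    field_simp

theorem iterate_derivative_comp_linear (g : ℚ[X]) (n : ℕ) :
    derivative^[n] (g.comp (C (1 / 2) * (1 - X))) =
      C ((-1 / 2 : ℚ) ^ n) * (derivative^[n] g).comp (C (1 / 2) * (1 - X)) := by
  induction n with
  | zero => simp
  | succ n ih =>
    rw [Function.iterate_succ_apply', ih, Function.iterate_succ_apply', derivative_C_mul,
      derivative_comp, pow_succ, C_mul]
    have : derivative (C (1 / 2 : ℚ) * (1 - X)) = C (-1 / 2 : ℚ) := by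
      rw [derivative_C_mul]
      simp only [derivative_sub, derivative_one, derivative_X, zero_sub, mul_neg, mul_one, ← C_neg]
      congr 1; norm_num
    rw [this]; ring

theorem legendrePoly_eq_shiftedLegendre_comp (n : ℕ) :
    legendrePoly n =
      ((shiftedLegendre n).map (Int.castRingHom ℚ)).comp (C (1 / 2) * (1 - X)) := by
  have h1 := congrArg (Polynomial.map (Int.castRingHom ℚ)) (factorial_mul_shiftedLegendre_eq n)
  rw [← iterate_derivative_map] at h1
  have h2 := iterate_derivative_comp_linear
    (Polynomial.map (Int.castRingHom ℚ) (X ^ n * (1 - X) ^ n)) n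
  rw [← h1] at h2
  have h3 : (Polynomial.map (Int.castRingHom ℚ) (X ^ n * (1 - X) ^ n)).comp
      (C (1 / 2) * (1 - X)) = C ((-1 / 4 : ℚ) ^ n) * (X ^ 2 - 1) ^ n := by
    have e : (C (1 / 2 : ℚ) : ℚ[X]) * (1 - X) * (1 - C (1 / 2) * (1 - X)) =
        C (-1 / 4) * (X ^ 2 - 1) := by
      have e1 : (C (1 / 2 : ℚ) : ℚ[X]) * 2 = 1 := by
        rw [← map_ofNat C, ← C_mul]; norm_num
      have e2 : (C (-1 / 4 : ℚ) : ℚ[X]) = -C (1 / 2) * C (1 / 2) := by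
        rw [← C_neg, ← C_mul]; norm_num
      rw [e2]
      linear_combination (-C (1 / 2) * (1 - X)) * e1
    simp only [Polynomial.map_mul, Polynomial.map_pow, map_X, Polynomial.map_sub,
      Polynomial.map_one, mul_comp, pow_comp, X_comp, sub_comp, one_comp]
    rw [← mul_pow, e, mul_pow, C_pow]
  rw [h3, iterate_derivative_C_mul, iterate_derivative_sq_sub_one_pow] at h2
  have hf : (n.factorial : ℚ) ≠ 0 := by positivity
  have hc : ((-1 / 2 : ℚ) ^ n * n.factorial) ≠ 0 := by
    refine mul_ne_zero (pow_ne_zero _ (by norm_num)) hf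
  refine mul_left_cancel₀ (C_ne_zero.2 hc) ?_
  rw [← mul_assoc, ← C_mul] at h2
  have e4 : (-1 / 4 : ℚ) ^ n * (n.factorial * 2 ^ n) = (-1 / 2 : ℚ) ^ n * n.factorial := by
    rw [show (-1 / 4 : ℚ) ^ n * (n.factorial * 2 ^ n) = ((-1 / 4) * 2) ^ n * n.factorial by
      rw [mul_pow]; ring]
    norm_num
  rw [e4] at h2
  rw [h2, C_mul, mul_assoc]
  simp

theorem aeval_legendrePoly {L : Type*} [Field L] [Algebra ℚ L] (n : ℕ) (t : L) :
    aeval t (legendrePoly n) = ∑ k ∈ range (n + 1),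
      (-1) ^ k * (n.choose k * (n + k).choose n : ℕ) * ((1 - t) / 2) ^ k := by
  have hc : (algebraMap ℚ L).comp (Int.castRingHom ℚ) = Int.castRingHom L := RingHom.ext_int _ _
  rw [legendrePoly_eq_shiftedLegendre_comp, aeval_comp, shiftedLegendre]
  simp only [Polynomial.map_sum, Polynomial.map_mul, Polynomial.map_pow, map_X, map_C,
    map_sum, map_mul, map_pow, aeval_X, aeval_C]
  refine sum_congr rfl fun k _ => ?_
  have : algebraMap ℚ L (1 / 2) * aeval t (1 - X : ℚ[X]) = (1 - t) / 2 := by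
    rw [map_sub, map_one, aeval_X, map_div₀, map_one, map_ofNat]; ring
  rw [this]
  simp [mul_assoc]

/-- The numerator `4^n P_n(5/s)`, for `s² = -2`, as a polynomial expression in `s` with integer
coefficients; see `four_pow_mul_aeval_legendrePoly`. -/
def legendreNum {R : Type*} [CommRing R] (n : ℕ) (s : R) : R :=
  ∑ k ∈ range (n + 1),
    (-1) ^ k * (n.choose k * (n + k).choose n : ℕ) * (2 + 5 * s) ^ k * 4 ^ (n - k)

theorem map_legendreNum {R S : Type*} [CommRing R] [CommRing S] (f : R →+* S) (n : ℕ) (s : R) :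
    f (legendreNum n s) = legendreNum n (f s) := by
  have h2 : f 2 = 2 := map_ofNat f 2
  have h4 : f 4 = 4 := map_ofNat f 4
  have h5 : f 5 = 5 := map_ofNat f 5
  simp [legendreNum, h2, h4, h5]

theorem four_pow_mul_aeval_legendrePoly {L : Type*} [Field L] [Algebra ℚ L] (n : ℕ) {s : L}
    (hs : s ^ 2 = -2) : 4 ^ n * aeval (5 / s) (legendrePoly n) = legendreNum n s := by
  have : CharZero L := algebraRat.charZero L
  have hs0 : s ≠ 0 := fun e => by
    rw [e] at hs
    norm_num at hs
  have ht : (1 - 5 / s) / 2 = (2 + 5 * s) / 4 := by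
    field_simp
    linear_combination (-10) * hs
  rw [aeval_legendrePoly, ht, legendreNum, mul_sum]
  refine sum_congr rfl fun k hk => ?_
  have hk : k ≤ n := by rw [mem_range] at hk; omega
  rw [show (4 : L) ^ n = 4 ^ (n - k) * 4 ^ k by rw [← pow_add]; congr 1; omega, div_pow]
  field_simp

/-- The truncated sum `∑_{k ≤ p/3} C(2k,k) C(3k,k) u^k`. -/
def hasseSum {R : Type*} [CommRing R] (p : ℕ) (u : R) : R :=
  ∑ k ∈ range (p / 3 + 1), ((2 * k).choose k * (3 * k).choose k : ℕ) * u ^ k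

/-! ### Values modulo `p` at `u = (2 + 5√-2) / 108` -/

section ModP
variable {p : ℕ} [Fact p.Prime] {R : Type*} [CommRing R]

theorem legendreNum_eq (hp3 : p ≠ 3) (hR : (p : R) = 0) {s v : R} (hv : 108 * v = 1) :
    legendreNum (p / 3) s = 4 ^ (p / 3) * hasseSum p ((2 + 5 * s) * v) := by
  rw [legendreNum, hasseSum, mul_sum]
  refine sum_congr rfl fun k hk => ?_
  have hk : k ≤ p / 3 := by rw [mem_range] at hk; omega
  have h := intCast_eq_of_zmod hR
    (a := ((p / 3).choose k * (p / 3 + k).choose (p / 3) : ℕ) * (-27) ^ k)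
    (b := ((2 * k).choose k * (3 * k).choose k : ℕ)) (by
      have := choose_third_mul hp3 hk
      push_cast at this ⊢
      exact this)
  rw [Int.cast_natCast, Int.cast_mul, Int.cast_natCast] at h
  rw [← h, show (4 : R) ^ (p / 3) = 4 ^ (p / 3 - k) * 4 ^ k by
    rw [← pow_add]; congr 1; omega, mul_pow]
  have h1 : (4 * 27 * v) ^ k = 1 := by
    rw [show 4 * 27 * v = 108 * v by ring, hv, one_pow]
  rw [mul_pow, mul_pow] at h1
  push_cast
  rw [neg_pow (27 : R)]
  linear_combination (-((-1) ^ k * ((p / 3).choose k * (p / 3 + k).choose (p / 3)) *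
    (2 + 5 * s) ^ k * 4 ^ (p / 3 - k))) * h1

theorem sum_range_eq_hasseSum (hR : (p : R) = 0) (u : R) :
    ∑ k ∈ range p, (((2 * k).choose k * (3 * k).choose k : ℕ) : R) * u ^ k = hasseSum p u := by
  have hpp : p.Prime := Fact.out
  have := hpp.two_le
  symm
  refine sum_subset (range_subset_range.2 (by omega)) fun k hk hk' => ?_
  rw [mem_range] at hk hk'
  obtain ⟨m, hm⟩ := dvd_choose_mul_choose hpp (show p ≤ 3 * k by omega) hk
  rw [hm, Nat.cast_mul, hR, zero_mul, zero_mul]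

theorem exists_natCast_mul_eq_one {N m : ℕ} (hm : Nat.Coprime m N) (hN : (N : R) = 0) :
    ∃ v : R, m * v = 1 := by
  obtain ⟨a, b, h⟩ := Nat.isCoprime_iff_coprime.2 hm
  refine ⟨a, ?_⟩
  have := congrArg (Int.cast : ℤ → R) h
  push_cast at this
  rw [hN, mul_zero, add_zero] at this
  rw [mul_comm, this]

theorem coprime_hundredEight (hp2 : p ≠ 2) (hp3 : p ≠ 3) : Nat.Coprime 108 p := by
  have hpp : p.Prime := Fact.out
  rw [show 108 = 2 ^ 2 * 3 ^ 3 by norm_num]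
  exact Nat.Coprime.mul_left
    (Nat.Coprime.pow_left _ ((Nat.coprime_primes Nat.prime_two hpp).2 hp2.symm))
    (Nat.Coprime.pow_left _ ((Nat.coprime_primes Nat.prime_three hpp).2 hp3.symm))

theorem hasseSum_eq_zero (hp : p % 8 = 5 ∨ p % 8 = 7) (hR : (p : R) = 0) {s v : R}
    (hs : s ^ 2 = -2) (hv : 108 * v = 1) : hasseSum p ((2 + 5 * s) * v) = 0 := by
  have h := hasse_eq (p := p) (n := p / 2) (by omega) (by omega) hR hs hv rfl rfl
  rw [cubicCharSum_eq_zero hp, Int.cast_zero, neg_zero, mul_zero] at h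
  have hu : IsUnit ((16 * (-(4 + 2 * s)) ^ 3) ^ (p / 2)) := by
    have h16 : IsUnit (16 : R) := by
      refine IsUnit.of_mul_eq_one ((27 * v) ^ 2) ?_
      linear_combination (108 * v + 1) * hv
    have hw : IsUnit (-(4 + 2 * s)) := by
      refine IsUnit.of_mul_eq_one ((s - 2) * (9 * v)) ?_
      linear_combination (-18 * v) * hs + hv
    exact (h16.mul (hw.pow 3)).pow _
  exact (hu.mul_right_eq_zero).1 h

theorem hasseSum_zmod (hp : p % 8 = 1 ∨ p % 8 = 3) (hp3 : p ≠ 3) {c d : ℤ}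
    (hcd : (p : ℤ) = c ^ 2 + 2 * d ^ 2) (hc : c ≡ 1 [ZMOD 4]) {s v : ZMod p}
    (hs : s ^ 2 = -2) (hv : 108 * v = 1) : hasseSum p ((2 + 5 * s) * v) =
      ((-1) ^ (p / 8) * quadraticChar (ZMod p) (-2 - s) * (2 * c) : ℤ) := by
  have h := hasse_eq (p := p) (n := p / 2) hp3 (by omega) (by simp) hs hv rfl rfl
  rw [cubicCharSum_eq hp hcd hc] at h
  have hF : ringChar (ZMod p) ≠ 2 := ringChar_zmod_ne_two (by omega)
  set χ := quadraticChar (ZMod p) with hχ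
  have h2 : (2 : ZMod p) ≠ 0 := Ring.two_ne_zero hF
  have h4 : (4 : ZMod p) ≠ 0 := by
    rw [show (4 : ZMod p) = 2 ^ 2 by norm_num]; exact pow_ne_zero _ h2
  have hw : -(4 + 2 * s) ≠ 0 := fun e => by
    have : (1 : ZMod p) = 0 := by
      rw [← hv]
      linear_combination (18 * v) * hs + (s - 2) * (9 * v) * e
    exact one_ne_zero this
  have hm2 : χ (-2) = 1 := quadraticChar_neg_two_eq_one hp
  rw [ZMod.pow_card_sub_one_eq_one (mul_ne_zero h4 hw), one_mul,
    show (16 : ZMod p) * (-(4 + 2 * s)) ^ 3 =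
      -(4 + 2 * s) * (4 * -(4 + 2 * s)) ^ 2 by ring] at h
  have hpow := quadraticChar_eq_pow_of_char_ne_two' hF (-(4 + 2 * s) * (4 * -(4 + 2 * s)) ^ 2)
  rw [ZMod.card, map_mul, quadraticChar_sq_one' (mul_ne_zero h4 hw), mul_one, ← hχ] at hpow
  rw [← hpow] at h
  have h1 : χ (-(4 + 2 * s)) * χ (-1) = χ (-2 - s) := by
    rw [← map_mul, show -(4 + 2 * s) * -1 = -2 * (-2 - s) by ring, map_mul, hm2, one_mul]
  have hsq : χ (-(4 + 2 * s)) * χ (-(4 + 2 * s)) = 1 := by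
    rw [← sq]; exact quadraticChar_sq_one hw
  rw [← h1]
  have hsq' := congrArg (Int.cast : ℤ → ZMod p) hsq
  change _ * hasseSum p _ = _ at h
  push_cast at hsq' h ⊢
  linear_combination (χ (-(4 + 2 * s)) : ZMod p) * h - hasseSum p ((2 + 5 * s) * v) * hsq'

end ModP

/-! ### The sums over `C(2k,k)² C(3k,k) / 8^k` -/

theorem intCast_div_mem_pIntegralRat {p b : ℕ} (z : ℤ) (hb : Nat.Coprime b p) :
    (z : ℚ) / b ∈ pIntegralRat p := by
  have h := Rat.den_dvd z b
  rw [Rat.divInt_eq_div] at h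
  exact Nat.Coprime.coprime_dvd_left (by exact_mod_cast h) hb

theorem coprime_two_pow_pow {p : ℕ} [Fact p.Prime] (hp2 : p ≠ 2) (a b : ℕ) :
    Nat.Coprime ((2 ^ a) ^ b) p := by
  rw [← pow_mul]
  exact Nat.Coprime.pow_left _ ((Nat.coprime_primes Nat.prime_two Fact.out).2 hp2.symm)

/-- The integer `8^{p-1} ∑_{k<p} C(2k,k)² C(3k,k) / 8^k`. -/
def clausenNum (p : ℕ) : ℤ :=
  ∑ k ∈ range p, ((2 * k).choose k ^ 2 * (3 * k).choose k : ℕ) * 8 ^ (p - 1 - k)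

theorem sum_div_eq_clausenNum (p : ℕ) :
    ∑ k ∈ range p, ((2 * k).choose k : ℚ) ^ 2 * ((3 * k).choose k : ℚ) / 8 ^ k =
      (clausenNum p : ℚ) / 8 ^ (p - 1) := by
  rw [clausenNum, Int.cast_sum, sum_div]
  refine sum_congr rfl fun k hk => ?_
  rw [show (8 : ℚ) ^ (p - 1) = 8 ^ (p - 1 - k) * 8 ^ k by
    rw [← pow_add]; congr 1; rw [mem_range] at hk; omega]
  push_cast
  field_simp

theorem congrMod_of_dvd_clausenNum {p m : ℕ} [Fact p.Prime] (hp2 : p ≠ 2) (a : ℤ)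
    (h : (m : ℤ) ∣ clausenNum p - a * 8 ^ (p - 1)) :
    CongrMod (pIntegralRat p) m
      (∑ k ∈ range p, ((2 * k).choose k : ℚ) ^ 2 * ((3 * k).choose k : ℚ) / 8 ^ k) a := by
  obtain ⟨z, hz⟩ := h
  refine ⟨(z : ℚ) / ((2 ^ 3) ^ (p - 1) : ℕ), intCast_div_mem_pIntegralRat z
    (coprime_two_pow_pow hp2 3 (p - 1)), ?_⟩
  have hz' := congrArg (Int.cast : ℤ → ℚ) hz
  push_cast at hz'
  rw [sum_div_eq_clausenNum]
  push_cast
  field_simp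
  linear_combination hz'

/-- At `u = (2 + 5√-2) / 108`, where `v` is the inverse of `108`, one has `u (1 - 27u) = 1/8`. -/
theorem eight_mul_clausen_arg {R : Type*} [CommRing R] {s v : R} (hs : s ^ 2 = -2)
    (hv : 108 * v = 1) :
    8 * (((2 + 5 * s) * v) * (1 - 27 * ((2 + 5 * s) * v))) = 1 := by
  grind

theorem intCast_clausenNum {p : ℕ} [Fact p.Prime] {R : Type*} [CommRing R]
    (hR : (p : R) ^ 2 = 0) {s v : R} (hs : s ^ 2 = -2) (hv : 108 * v = 1) :
    (clausenNum p : R) = 8 ^ (p - 1) *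
      (∑ k ∈ range p, (((2 * k).choose k * (3 * k).choose k : ℕ) : R) *
        ((2 + 5 * s) * v) ^ k) ^ 2 := by
  have h8 := eight_mul_clausen_arg hs hv
  rw [← sum_clausen_eq_sq Fact.out hR, clausenNum, Int.cast_sum, mul_sum]
  refine sum_congr rfl fun k hk => ?_
  rw [show (8 : R) ^ (p - 1) = 8 ^ (p - 1 - k) * 8 ^ k by
    rw [← pow_add]; congr 1; rw [mem_range] at hk; omega]
  generalize (2 + 5 * s) * v * (1 - 27 * ((2 + 5 * s) * v)) = e at *
  have h8k : (8 * e) ^ k = 1 := by rw [h8, one_pow]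
  rw [mul_pow] at h8k
  push_cast
  linear_combination (-(((2 * k).choose k : R) ^ 2 * (3 * k).choose k * 8 ^ (p - 1 - k))) * h8k

/-! ### Primes congruent to `5` or `7` modulo `8` -/

section Inert
variable {p : ℕ} [Fact p.Prime]

theorem sqrtd_neg_two_sq : (Zsqrtd.sqrtd : ℤ√(-2)) ^ 2 = -2 := by
  rw [sq, Zsqrtd.dmuld]; simp

theorem dvd_legendreNum (hp : p % 8 = 5 ∨ p % 8 = 7) :
    (p : ℤ√(-2)) ∣ legendreNum (p / 3) Zsqrtd.sqrtd := by
  set q := Ideal.Quotient.mk (Ideal.span {(p : ℤ√(-2))}) with hq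
  have hR : ((p : ℕ) : ℤ√(-2) ⧸ Ideal.span {(p : ℤ√(-2))}) = 0 := by
    rw [← map_natCast q, hq, Ideal.Quotient.eq_zero_iff_mem]
    exact Ideal.mem_span_singleton_self _
  obtain ⟨v, hv⟩ :=
    exists_natCast_mul_eq_one (coprime_hundredEight (p := p) (by omega) (by omega)) hR
  have hs : (q Zsqrtd.sqrtd) ^ 2 = -2 := by
    rw [← map_pow, sqrtd_neg_two_sq, map_neg, map_ofNat q 2]
  push_cast at hv
  rw [← Ideal.mem_span_singleton, ← Ideal.Quotient.eq_zero_iff_mem, ← hq, map_legendreNum,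
    legendreNum_eq (by omega) hR hv, hasseSum_eq_zero hp hR hs hv, mul_zero]

/-- The sum is a square modulo `p²` in `ℤ[√-2]`, and its square root vanishes modulo `p`. The
square root is cleared of denominators in `T`, so that divisibility by `p` can be used modulo
`p²`. -/
theorem sq_dvd_clausenNum (hp : p % 8 = 5 ∨ p % 8 = 7) :
    (p : ℤ) ^ 2 ∣ clausenNum p := by
  set T : ℤ√(-2) := ∑ k ∈ range p, (((2 * k).choose k * (3 * k).choose k : ℕ) : ℤ√(-2)) *
    (2 + 5 * Zsqrtd.sqrtd) ^ k * 108 ^ (p - 1 - k) with hT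
  have hmap : ∀ (R : Type) [CommRing R] (f : ℤ√(-2) →+* R) (v : R), 108 * v = 1 →
      f T = 108 ^ (p - 1) * ∑ k ∈ range p, (((2 * k).choose k * (3 * k).choose k : ℕ) : R) *
        ((2 + 5 * f Zsqrtd.sqrtd) * v) ^ k := by
    intro R _ f v hv
    have h2 : f 2 = 2 := map_ofNat f 2
    have h5 : f 5 = 5 := map_ofNat f 5
    have h108 : f 108 = 108 := map_ofNat f 108
    rw [hT, map_sum, mul_sum]
    refine sum_congr rfl fun k hk => ?_
    rw [map_mul, map_mul, map_pow, map_pow, map_add, map_mul, h2, h5, h108, map_natCast,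
      show (108 : R) ^ (p - 1) = 108 ^ (p - 1 - k) * 108 ^ k by
        rw [← pow_add]; congr 1; rw [mem_range] at hk; omega]
    have hvk : (108 * v) ^ k = 1 := by rw [hv, one_pow]
    rw [mul_pow] at hvk ⊢
    linear_combination (-((((2 * k).choose k * (3 * k).choose k : ℕ) : R) *
      (2 + 5 * f Zsqrtd.sqrtd) ^ k * 108 ^ (p - 1 - k))) * hvk
  have hdvd : (p : ℤ√(-2)) ∣ T := by
    set q := Ideal.Quotient.mk (Ideal.span {(p : ℤ√(-2))}) with hq
    have hR : ((p : ℕ) : ℤ√(-2) ⧸ Ideal.span {(p : ℤ√(-2))}) = 0 := by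
      rw [← map_natCast q, hq, Ideal.Quotient.eq_zero_iff_mem]
      exact Ideal.mem_span_singleton_self _
    obtain ⟨v, hv⟩ :=
      exists_natCast_mul_eq_one (coprime_hundredEight (p := p) (by omega) (by omega)) hR
    have hs : (q Zsqrtd.sqrtd) ^ 2 = -2 := by
      rw [← map_pow, sqrtd_neg_two_sq, map_neg, map_ofNat q 2]
    push_cast at hv
    rw [← Ideal.mem_span_singleton, ← Ideal.Quotient.eq_zero_iff_mem, ← hq, hmap _ q v hv,
      sum_range_eq_hasseSum hR, hasseSum_eq_zero hp hR hs hv, mul_zero]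
  obtain ⟨T', hT'⟩ := hdvd
  set q := Ideal.Quotient.mk (Ideal.span {(p : ℤ√(-2)) ^ 2}) with hq
  have hR : ((p : ℕ) : ℤ√(-2) ⧸ Ideal.span {(p : ℤ√(-2)) ^ 2}) ^ 2 = 0 := by
    rw [← map_natCast q, ← map_pow, hq, Ideal.Quotient.eq_zero_iff_mem]
    exact Ideal.mem_span_singleton_self _
  obtain ⟨v, hv⟩ := exists_natCast_mul_eq_one (R := ℤ√(-2) ⧸ Ideal.span {(p : ℤ√(-2)) ^ 2})
    (N := p ^ 2) ((coprime_hundredEight (p := p) (by omega)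
    (by omega)).pow_right 2) (by rw [Nat.cast_pow]; exact hR)
  push_cast at hv
  have hs : (q Zsqrtd.sqrtd) ^ 2 = -2 := by
    rw [← map_pow, sqrtd_neg_two_sq, map_neg, map_ofNat q 2]
  have h1 := intCast_clausenNum hR hs hv
  have h2 : (∑ k ∈ range p, (((2 * k).choose k * (3 * k).choose k : ℕ) :
      ℤ√(-2) ⧸ Ideal.span {(p : ℤ√(-2)) ^ 2}) * ((2 + 5 * q Zsqrtd.sqrtd) * v) ^ k) ^ 2 = 0 := by
    have h3 := hmap _ q v hv
    rw [hT', map_mul, map_natCast] at h3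
    have h4 : ((108 : ℤ√(-2) ⧸ Ideal.span {(p : ℤ√(-2)) ^ 2}) * v) ^ (p - 1) = 1 := by
      rw [hv, one_pow]
    rw [mul_pow] at h4
    have h5 := congrArg (fun x : ℤ√(-2) ⧸ Ideal.span {(p : ℤ√(-2)) ^ 2} => (v ^ (p - 1) * x) ^ 2) h3
    simp only [← mul_assoc, mul_comm (v ^ (p - 1)) (108 ^ (p - 1)), h4, one_mul] at h5
    rw [← h5]
    linear_combination (v ^ (p - 1) * q T') ^ 2 * hR
  rw [h2, mul_zero, ← map_intCast q, hq, Ideal.Quotient.eq_zero_iff_mem,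
    Ideal.mem_span_singleton] at h1
  rw [← Zsqrtd.intCast_dvd_intCast (d := -2)]
  exact_mod_cast h1

end Inert

/-! ### The congruences -/

theorem exists_sign_modEq_one {c : ℤ} (hc : c % 2 = 1) :
    ∃ c' : ℤ, c' ^ 2 = c ^ 2 ∧ c' ≡ 1 [ZMOD 4] := by
  rcases (by omega : c % 4 = 1 ∨ c % 4 = 3) with h | h
  · exact ⟨c, rfl, h⟩
  · refine ⟨-c, neg_sq c, ?_⟩
    unfold Int.ModEq
    omega

theorem dvd_clausenNum_sub_four_mul_sq {p : ℕ} [Fact p.Prime] (hp : p % 8 = 1 ∨ p % 8 = 3) {c d : ℤ}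
    (hcd : (p : ℤ) = c ^ 2 + 2 * d ^ 2) :
    (p : ℤ) ∣ clausenNum p - 4 * c ^ 2 * 8 ^ (p - 1) := by
  -- For `p = 3` the number `108` is not invertible; here the sum is evaluated.
  by_cases hp3 : p = 3
  · subst hp3
    have hc : c ^ 2 = 1 := by
      exact sq_eq_sq_of_sq_add_two_mul_sq Nat.prime_three hcd (c := 1) (d := 1) (by norm_num)
    rw [hc]
    decide
  have hc2 : c % 2 = 1 := by
    by_contra h
    obtain ⟨m, rfl⟩ : (2 : ℤ) ∣ c := by omega
    have : (p : ℤ) = 2 * (2 * m ^ 2 + d ^ 2) := by rw [hcd]; ring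
    omega
  obtain ⟨c', hc', hc1⟩ := exists_sign_modEq_one hc2
  rw [← hc'] at hcd ⊢
  have hF : ringChar (ZMod p) ≠ 2 := ringChar_zmod_ne_two (by omega)
  have hm2 := quadraticChar_neg_two_eq_one hp
  have h20 : (-2 : ZMod p) ≠ 0 := neg_ne_zero.2 (Ring.two_ne_zero hF)
  obtain ⟨s, hs⟩ := (quadraticChar_one_iff_isSquare h20).1 hm2
  have hs : s ^ 2 = -2 := by rw [hs, sq]
  have hR : ((p : ℕ) : ZMod p) = 0 := by simp
  obtain ⟨v, hv⟩ := exists_natCast_mul_eq_one (coprime_hundredEight (p := p) (by omega) hp3) hR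
  push_cast at hv
  have h1 := intCast_clausenNum (by rw [hR]; ring) hs hv
  rw [sum_range_eq_hasseSum hR, hasseSum_zmod hp hp3 hcd hc1 hs hv] at h1
  have hs2 : (-2 - s : ZMod p) ≠ 0 := fun e => by
    have : (1 : ZMod p) = 0 := by
      rw [← hv]
      linear_combination (18 * v) * hs + 18 * v * (s - 2) * e
    exact one_ne_zero this
  have hsq : ((-1) ^ (p / 8) * quadraticChar (ZMod p) (-2 - s) * (2 * c')) ^ 2 = 4 * c' ^ 2 := by
    rw [mul_pow, mul_pow, quadraticChar_sq_one hs2, ← pow_mul, mul_comm (p / 8), pow_mul]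
    ring
  rw [← Int.cast_pow, hsq] at h1
  rw [← ZMod.intCast_zmod_eq_zero_iff_dvd]
  push_cast at h1 ⊢
  rw [h1]
  ring

theorem congrMod_aeval_legendrePoly_padic {p : ℕ} [Fact p.Prime] (hp : p % 8 = 1 ∨ p % 8 = 3)
    (hp3 : p ≠ 3) {c d : ℤ} (hcd : (p : ℤ) = c ^ 2 + 2 * d ^ 2) (hc : c ≡ 1 [ZMOD 4]) {s : ℤ_[p]}
    (hs : s ^ 2 = -2) : CongrMod (padicIntegers p) p
      (aeval (5 / (s : ℚ_[p])) (legendrePoly (p / 3)))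
      ((-1) ^ (p / 8) * (padicLegendreSym p (-2 - s) : ℚ_[p]) * (2 * (c : ℚ_[p]))) := by
  have hR : ((p : ℕ) : ZMod p) = 0 := by simp
  obtain ⟨v, hv⟩ := exists_natCast_mul_eq_one (coprime_hundredEight (p := p) (by omega) hp3) hR
  push_cast at hv
  set φ := PadicInt.toZMod (p := p)
  have hs' : (φ s) ^ 2 = -2 := by rw [← map_pow, hs, map_neg, map_ofNat φ 2]
  have hφ : φ (-2 - s) = -2 - φ s := by rw [map_sub, map_neg, map_ofNat φ 2]
  set N : ℤ := (-1) ^ (p / 8) * padicLegendreSym p (-2 - s) * (2 * c) with hN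
  have h0 : φ (legendreNum (p / 3) s - 4 ^ (p / 3) * (N : ℤ_[p])) = 0 := by
    rw [map_sub, map_legendreNum, legendreNum_eq hp3 hR hv, hasseSum_zmod hp hp3 hcd hc hs' hv,
      map_mul, map_pow, map_ofNat φ 4, map_intCast, hN, padicLegendreSym, hφ, sub_self]
  rw [← RingHom.mem_ker, PadicInt.ker_toZMod, PadicInt.maximalIdeal_eq_span_p,
    Ideal.mem_span_singleton] at h0
  obtain ⟨z, hz⟩ := h0
  have h4 : ‖(4 : ℚ_[p])‖ = 1 := by
    have := (Padic.norm_natCast_eq_one_iff (p := p) (n := 4)).2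
      (coprime_two_pow_pow (p := p) (by omega) 2 1).symm
    exact_mod_cast this
  have hsQ : (s : ℚ_[p]) ^ 2 = -2 := by
    have := congrArg (fun x : ℤ_[p] => (x : ℚ_[p])) hs
    push_cast at this
    exact this
  have hz' := congrArg (fun x : ℤ_[p] => (x : ℚ_[p])) hz
  have hnum : ((legendreNum (p / 3) s : ℤ_[p]) : ℚ_[p]) = legendreNum (p / 3) (s : ℚ_[p]) :=
    map_legendreNum PadicInt.Coe.ringHom _ _
  have h40 : (4 : ℚ_[p]) ^ (p / 3) ≠ 0 := pow_ne_zero _ (by norm_num)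
  refine ⟨z / 4 ^ (p / 3), ?_, ?_⟩
  · change ‖(z : ℚ_[p]) / 4 ^ (p / 3)‖ ≤ 1
    rw [norm_div, norm_pow, h4, one_pow, div_one]
    exact z.2
  · have c2 : ((2 : ℤ_[p]) : ℚ_[p]) = 2 := map_ofNat PadicInt.Coe.ringHom 2
    have c4 : ((4 : ℤ_[p]) : ℚ_[p]) = 4 := map_ofNat PadicInt.Coe.ringHom 4
    push_cast [hnum, hN, c2, c4] at hz'
    rw [← four_pow_mul_aeval_legendrePoly _ hsQ] at hz'
    refine mul_left_cancel₀ h40 ?_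
    field_simp
    linear_combination hz'

theorem congrMod_aeval_legendrePoly_complex {p : ℕ} [Fact p.Prime] (hp : p % 8 = 5 ∨ p % 8 = 7)
    {s : ℂ} (hs : s ^ 2 = -2) :
    CongrMod (pIntegralAdjoin p s) p (aeval (5 / s) (legendrePoly (p / 3))) 0 := by
  obtain ⟨z, hz⟩ := dvd_legendreNum hp
  have hs' : s * s = ((-2 : ℤ) : ℂ) := by rw [← sq, hs]; simp
  have h := congrArg (Zsqrtd.lift ⟨s, hs'⟩) hz
  rw [map_legendreNum, map_mul, map_natCast] at h
  have hsq : Zsqrtd.lift ⟨s, hs'⟩ Zsqrtd.sqrtd = s := by simp [Zsqrtd.lift]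
  have hzl : Zsqrtd.lift ⟨s, hs'⟩ z = z.re + z.im * s := by simp [Zsqrtd.lift]
  rw [hsq, hzl, ← four_pow_mul_aeval_legendrePoly _ hs] at h
  have hco := coprime_two_pow_pow (p := p) (by omega) 2 (p / 3)
  refine ⟨_, ⟨_, intCast_div_mem_pIntegralRat z.re hco, _,
    intCast_div_mem_pIntegralRat z.im hco, rfl⟩, ?_⟩
  have h40 : (4 : ℂ) ^ (p / 3) ≠ 0 := pow_ne_zero _ (by norm_num)
  refine mul_left_cancel₀ h40 ?_
  rw [sub_zero, h]
  push_cast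
  field_simp

theorem theorem4p3 (p : ℕ) [Fact p.Prime] (hp : p ≠ 2) :
    (p ≠ 3 → (p % 8 = 1 ∨ p % 8 = 3) →
      ∀ c d : ℤ, (p : ℤ) = c ^ 2 + 2 * d ^ 2 → c ≡ 1 [ZMOD 4] →
        ∀ s : ℤ_[p], s ^ 2 = -2 →
          CongrMod (padicIntegers p) p
            (aeval (5 / (s : ℚ_[p])) (legendrePoly (p / 3)))
            ((-1) ^ (p / 8) * (padicLegendreSym p (-2 - s) : ℚ_[p]) * (2 * (c : ℚ_[p])))) ∧
    ((p % 8 = 5 ∨ p % 8 = 7) →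
      ∀ s : ℂ, s ^ 2 = -2 →
        CongrMod (pIntegralAdjoin p s) p (aeval (5 / s) (legendrePoly (p / 3))) 0) ∧
    ((p % 8 = 1 ∨ p % 8 = 3) →
      ∀ c d : ℤ, (p : ℤ) = c ^ 2 + 2 * d ^ 2 →
        CongrMod (pIntegralRat p) p
          (∑ k ∈ range p,
            ((2 * k).choose k : ℚ) ^ 2 * ((3 * k).choose k : ℚ) / 8 ^ k)
          (4 * (c : ℚ) ^ 2)) ∧
    ((p % 8 = 5 ∨ p % 8 = 7) →
      CongrMod (pIntegralRat p) (p ^ 2)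
        (∑ k ∈ range p,
          ((2 * k).choose k : ℚ) ^ 2 * ((3 * k).choose k : ℚ) / 8 ^ k)
        0) := by
  refine ⟨fun hp3 hp8 c d hcd hc s hs => congrMod_aeval_legendrePoly_padic hp8 hp3 hcd hc hs,
    fun hp8 s hs => congrMod_aeval_legendrePoly_complex hp8 hs,
    fun hp8 c d hcd => ?_, fun hp8 => ?_⟩
  · have := congrMod_of_dvd_clausenNum hp (4 * c ^ 2) (dvd_clausenNum_sub_four_mul_sq hp8 hcd)
    exact_mod_cast this
  · have := congrMod_of_dvd_clausenNum (m := p ^ 2) hp 0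
      (by rw [zero_mul, sub_zero]; exact_mod_cast sq_dvd_clausenNum hp8)
    exact_mod_cast this
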